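/- Let $Y$ and $Y_n$ ($n\in\mathbb N$) be random variables on a probability space $(\Omega,\mathcal A,\mathbb P)$ with values in a measurable space $(E,\mathcal F)$, let $\mathbb P_Y$ be the law of $Y$ and $\mathbb E_Y$ the expectation under $\mathbb P_Y$, and let $\alpha_n>0$ for every $n$. Let $\mathcal D$ be an algebra of bounded measurable functions from $E$ to $\mathbb R$ or $\mathbb C$ (stable under conjugation in the complex case), containing the constants and dense in $L^2(E,\mathcal F,\mathbb P_Y)$; write $\mathcal D_{\mathbb R}$ for its real-valued elements. Assume (H3) for every $\varphi\in\mathcal D$ there is $\widetilde A[\varphi]\in L^2(\mathbb P_Y)$ such that for every $\chi\in\mathcal D$ $$\lim_{n\to\infty}\alpha_n\,\mathbb E\big[(\varphi(Y_n)-\varphi(Y))(\chi(Y_n)-\chi(Y))\big]=-2\,\mathbb E_Y\big[\widetilde A[\varphi]\,\chi\big].$$ Let $(\mathcal E,\mathbb D)$ be the smallest closed extension in the real space $L^2(\mathbb P_Y)$ of the closable form $$\widetilde{\mathcal E}[\varphi,\chi]=\lim_{n\to\infty}\frac{\alpha_n}{2}\mathbb E\big[(\varphi(Y_n)-\varphi(Y))(\chi(Y_n)-\chi(Y))\big],\qquad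 \varphi,\chi\in\mathcal D_{\mathbb R},$$ and assume that $(\mathcal E,\mathbb D)$ is local, i.e. $\mathcal E[F(u)-F(0),\,G(u)-G(0)]=0$ for all $u\in\mathbb D$ and all $F,G\in C_c^\infty(\mathbb R)$ with disjoint supports. For $\varphi,\chi\in\mathcal D_{\mathbb R}$ put $$\Gamma[\varphi,\chi]=\widetilde A[\varphi\chi]-\varphi\,\widetilde A[\chi]-\chi\,\widetilde A[\varphi].$$ Then $\Gamma$ is the square field operator of $(\mathcal E,\mathbb D)$ on $\mathcal D_{\mathbb R}$: for all $f,g\in\mathcal D_{\mathbb R}$ and all $h\in\mathbb D\cap L^\infty(\mathbb P_Y)$, one has $f,\,fg,\,fh,\,gh\in\mathbb D$, $\Gamma[f,g]\in L^1(\mathbb P_Y)$ and $$\mathbb E_Y\big[h\,\Gamma[f,g]\big]=\mathcal E[fh,g]+\mathcal E[gh,f]-\mathcal E[h,fg].$$ Moreover the asymptotic error calculus principle is valid on $\{F(f_1,\dots,f_p): f_i\in\mathcal D_{\mathbb R},\ F\in C^1(\mathbb R^p,\mathbb R)\}$: for every $p$, all $f_1,\dots,f_p\in\mathcal D_{\mathbb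 R}$ and every $F\in C^1(\mathbb R^p,\mathbb R)$, the random variable $\sum_{i,j=1}^pF'_i(f_1,\dots,f_p)F'_j(f_1,\dots,f_p)\Gamma[f_i,f_j]$ is $\mathbb P_Y$-integrable and $$\lim_{n\to\infty}\alpha_n\,\mathbb E\Big[\big(F(f_1(Y_n),\dots,f_p(Y_n))-F(f_1(Y),\dots,f_p(Y))\big)^2\Big]=\mathbb E_Y\Big[\sum_{i,j=1}^pF'_i(f_1,\dots,f_p)\,F'_j(f_1,\dots,f_p)\,\Gamma[f_i,f_j]\Big].$$ -/

import Mathlib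

open Filter Topology MeasureTheory
open scoped ContDiff

noncomputable section

namespace ErrorCalculus

variable {Ω E 𝕜 : Type*} [MeasurableSpace Ω] [MeasurableSpace E] [RCLike 𝕜]

/-- `𝒟` is an algebra of bounded measurable functions from `E` to `𝕜` (`ℝ` or `ℂ`), dense in
`L²(μ)`. A `StarSubalgebra` of `E → 𝕜` contains the constants and is stable under
complex conjugation (an empty condition for `𝕜 = ℝ`). -/
structure IsTestAlgebra (μ : Measure E) (𝒟 : StarSubalgebra 𝕜 (E → 𝕜)) : Prop where
  measurable : ∀ φ ∈ 𝒟, Measurable φ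
  bounded : ∀ φ ∈ 𝒟, ∃ C : ℝ, ∀ x, ‖φ x‖ ≤ C
  dense : ∀ u : E → 𝕜, MemLp u 2 μ → ∀ ε : ENNReal, 0 < ε → ∃ φ ∈ 𝒟, eLpNorm (u - φ) 2 μ < ε

/-- Hypothesis (H3), with the symmetric bias operator `A` that it provides: for all `φ ∈ 𝒟`,
`A φ ∈ L²(ℙ_Y)` and, for all `χ ∈ 𝒟`,
`α_n 𝔼[(φ(Y_n) - φ(Y)) (χ(Y_n) - χ(Y))] → -2 𝔼_Y[A φ · χ]`. -/
def IsSymmetricBias (P : Measure Ω) (Y : Ω → E) (Yn : ℕ → Ω → E) (α : ℕ → ℝ)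
    (𝒟 : StarSubalgebra 𝕜 (E → 𝕜)) (A : (E → 𝕜) → E → 𝕜) : Prop :=
  ∀ φ ∈ 𝒟, MemLp (A φ) 2 (P.map Y) ∧ ∀ χ ∈ 𝒟,
    Tendsto (fun n => (α n : 𝕜) *
        ∫ w, (φ (Yn n w) - φ (Y w)) * (χ (Yn n w) - χ (Y w)) ∂P)
      atTop (𝓝 (-2 * ∫ x, A φ x * χ x ∂(P.map Y)))

/-- A real function, seen as a `𝕜`-valued one. -/
def toK (𝕜 : Type*) [RCLike 𝕜] (φ : E → ℝ) : E → 𝕜 := fun x => (φ x : 𝕜)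

/-- The real-valued elements of `𝒟`. -/
def realPart (𝒟 : StarSubalgebra 𝕜 (E → 𝕜)) : Set (E → ℝ) := {φ | toK 𝕜 φ ∈ 𝒟}

/-- The form `lim_n (α_n / 2) 𝔼[(φ(Y_n) - φ(Y)) (χ(Y_n) - χ(Y))]` on the real test functions
(the limit exists under (H3)). -/
def preForm (P : Measure Ω) (Y : Ω → E) (Yn : ℕ → Ω → E) (α : ℕ → ℝ) (φ χ : E → ℝ) : ℝ :=
  limUnder atTop fun n =>
    α n / 2 * ∫ w, (φ (Yn n w) - φ (Y w)) * (χ (Yn n w) - χ (Y w)) ∂P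

/-- `φ_k ∈ C`, `φ_k → u` in `L²(μ)`, and `(φ_k)` is Cauchy for the quadratic form `q`. -/
def IsApproxSeq (μ : Measure E) (C : Set (E → ℝ)) (q : (E → ℝ) → (E → ℝ) → ℝ)
    (φ : ℕ → E → ℝ) (u : E → ℝ) : Prop :=
  (∀ k, φ k ∈ C) ∧ Tendsto (fun k => eLpNorm (φ k - u) 2 μ) atTop (𝓝 0) ∧
    Tendsto (fun k : ℕ × ℕ => q (φ k.1 - φ k.2) (φ k.1 - φ k.2)) atTop (𝓝 0)

/-- The domain of the smallest closed extension, in `L²(μ)`, of the form `q` on `C`. -/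
def closureDomain (μ : Measure E) (C : Set (E → ℝ)) (q : (E → ℝ) → (E → ℝ) → ℝ) :
    Set (E → ℝ) :=
  {u | MemLp u 2 μ ∧ ∃ φ, IsApproxSeq μ C q φ u}

open Classical in
/-- The smallest closed extension of the form `q` on `C`: its value at `(u, v)` is the limit of
`q φ_k ψ_k` along approximating sequences of `u` and `v` (which, for a closable form, does not
depend on the sequences). The value `0` outside of the domain is irrelevant. -/
def closureForm (μ : Measure E) (C : Set (E → ℝ)) (q : (E → ℝ) → (E → ℝ) → ℝ)
    (u v : E → ℝ) : ℝ :=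
  if h : ∃ r : ℝ, ∃ φ ψ : ℕ → E → ℝ, IsApproxSeq μ C q φ u ∧ IsApproxSeq μ C q ψ v ∧
      Tendsto (fun k => q (φ k) (ψ k)) atTop (𝓝 r)
  then h.choose else 0

/-- Locality of a Dirichlet form `(ℰ, 𝔻)` (on a measurable space, without topology):
`ℰ[F(u) - F(0), G(u) - G(0)] = 0` for all `u ∈ 𝔻` and all smooth, compactly supported `F`, `G` on
the real line with disjoint supports. -/
def IsLocal (𝔻 : Set (E → ℝ)) (ℰ : (E → ℝ) → (E → ℝ) → ℝ) : Prop :=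
  ∀ u ∈ 𝔻, ∀ F G : ℝ → ℝ, ContDiff ℝ ∞ F → ContDiff ℝ ∞ G →
    HasCompactSupport F → HasCompactSupport G → Disjoint (tsupport F) (tsupport G) →
    ℰ (fun x => F (u x) - F 0) (fun x => G (u x) - G 0) = 0

/-- `Γ` is, on the core `C ⊆ 𝔻 ∩ L^∞`, the square field operator of the Dirichlet form `(ℰ, 𝔻)`:
for `f, g ∈ C`, `Γ[f, g] ∈ L¹(μ)` and, for all `h ∈ 𝔻 ∩ L^∞`,
`∫ h Γ[f, g] dμ = ℰ[f h, g] + ℰ[g h, f] - ℰ[h, f g]` (the arguments being in `𝔻`). -/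
def IsSquareField (μ : Measure E) (C 𝔻 : Set (E → ℝ)) (ℰ : (E → ℝ) → (E → ℝ) → ℝ)
    (Γ : (E → ℝ) → (E → ℝ) → E → ℝ) : Prop :=
  ∀ f ∈ C, ∀ g ∈ C, f ∈ 𝔻 ∧ f * g ∈ 𝔻 ∧ Integrable (Γ f g) μ ∧
    ∀ h ∈ 𝔻, MemLp h ⊤ μ → f * h ∈ 𝔻 ∧
      ∫ x, h x * Γ f g x ∂μ = ℰ (f * h) g + ℰ (g * h) f - ℰ h (f * g)

/-- `Γ[φ, χ] = A[φ χ] - φ A[χ] - χ A[φ]`, the polarization of `Γ[φ] = A[φ²] - 2 φ A[φ]`, for real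
test functions. (`A` maps real test functions to almost everywhere real functions.) -/
def squareField (A : (E → 𝕜) → E → 𝕜) (φ χ : E → ℝ) : E → ℝ := fun x =>
  RCLike.re (A (toK 𝕜 (φ * χ)) x) - φ x * RCLike.re (A (toK 𝕜 χ) x)
    - χ x * RCLike.re (A (toK 𝕜 φ) x)

/-- The domain `𝔻` of the smallest closed extension of `preForm`. -/
def formDomain (P : Measure Ω) (Y : Ω → E) (Yn : ℕ → Ω → E) (α : ℕ → ℝ)
    (𝒟 : StarSubalgebra 𝕜 (E → 𝕜)) : Set (E → ℝ) :=
  closureDomain (P.map Y) (realPart 𝒟) (preForm P Y Yn α)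

/-- The smallest closed extension `ℰ` of `preForm`. -/
def form (P : Measure Ω) (Y : Ω → E) (Yn : ℕ → Ω → E) (α : ℕ → ℝ)
    (𝒟 : StarSubalgebra 𝕜 (E → 𝕜)) : (E → ℝ) → (E → ℝ) → ℝ :=
  closureForm (P.map Y) (realPart 𝒟) (preForm P Y Yn α)

end ErrorCalculus

end

/-! Let `ν n` be `α n` times the joint law of `(Y, Y_n)`, and let `incr φ` be the increment of `φ`
between the two points of a pair. Under (H3), the `ν n`-integral of `incr φ * incr χ` tends to `2 *
q φ χ`, where `q φ χ` is minus the `L²` pairing of `A φ` with `χ`. Two consequences drive the proof.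

Representation by an `L²` operator makes `q` closable, and for a test function `g` the closed form
at `(u, g)` is minus the pairing of `A g` with `u` (`closureForm_eq`). The square field identity is
then the expansion of the definition of `Γ`, provided `f * h` lies in the domain. To see that it
does, smoothly truncate the approximants of `h`: this keeps energies bounded, and an `L²` limit of
test functions of bounded energy is in the domain (`mem_closureDomain_of_bounded`).

For the error calculus, locality is transferred to `ν n`. Bumps with disjoint supports have zero
mutual energy, so the `ν n`-mass of `{δ ≤ |incr f|}` tends to zero (`tendsto_measureReal_incr`).
Since the energies are bounded, every bounded function that is `o` of the sum of squared increments
has vanishing integral (`tendsto_integral_of_abs_le_incr_sq`). This removes the triple product of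
increments, which identifies the weighted limit of `incr f * incr g` as an integral against `Γ`, and
it removes the Taylor remainder of `F`. The linear part of the increment of `F` gives the gradient
formula. -/

namespace ErrorCalculus

/-! ### Closability and the closed extension of a form represented in `L²` -/

/-- A nonnegative symmetric form `q` on an algebra `C` of square integrable functions, represented
by an operator `-B` with values in `L²`. -/
structure IsReprForm {E : Type*} [MeasurableSpace E] (μ : Measure E) (C : Subalgebra ℝ (E → ℝ))
    (B : (E → ℝ) → E → ℝ) (q : (E → ℝ) → (E → ℝ) → ℝ) : Prop where
  memLp : ∀ φ ∈ C, MemLp φ 2 μ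
  memLp_gen : ∀ φ ∈ C, MemLp (B φ) 2 μ
  repr : ∀ φ ∈ C, ∀ χ ∈ C, q φ χ = -∫ x, B φ x * χ x ∂μ
  symm : ∀ φ ∈ C, ∀ χ ∈ C, q φ χ = q χ φ
  nonneg : ∀ φ ∈ C, 0 ≤ q φ φ

/-- Pairing with a fixed `L²` function is continuous in `L²`. -/
theorem tendsto_integral_mul_of_tendsto_eLpNorm {E ι : Type*} [MeasurableSpace E] {μ : Measure E}
    {l : Filter ι} {φ : ι → E → ℝ} {u b : E → ℝ} (hφ : ∀ k, MemLp (φ k) 2 μ) (hu : MemLp u 2 μ)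
    (hb : MemLp b 2 μ) (h : Tendsto (fun k => eLpNorm (φ k - u) 2 μ) l (𝓝 0)) :
    Tendsto (fun k => ∫ x, b x * φ k x ∂μ) l (𝓝 (∫ x, b x * u x ∂μ)) := by
  refine tendsto_integral_of_L1 _ (hb.integrable_mul hu).aestronglyMeasurable
    (Eventually.of_forall fun k => hb.integrable_mul (hφ k)) ?_
  have h2 : Tendsto (fun k => eLpNorm b 2 μ * eLpNorm (φ k - u) 2 μ) l (𝓝 0) := by
    simpa using ENNReal.Tendsto.const_mul h (Or.inr hb.eLpNorm_ne_top)
  refine tendsto_of_tendsto_of_tendsto_of_le_of_le tendsto_const_nhds h2 (fun _ => zero_le) ?_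
  intro k
  have := eLpNorm_smul_le_mul_eLpNorm (p := 2) (q := 2) (r := 1)
    ((hφ k).sub hu).aestronglyMeasurable hb.aestronglyMeasurable
  refine le_trans (le_of_eq ?_) this
  rw [eLpNorm_one_eq_lintegral_enorm]
  refine lintegral_congr fun x => ?_
  simp [mul_sub]

variable {E : Type*} [MeasurableSpace E] {μ : Measure E} {C : Subalgebra ℝ (E → ℝ)}
  {B : (E → ℝ) → E → ℝ} {q : (E → ℝ) → (E → ℝ) → ℝ}

namespace IsReprForm

theorem add_right (hq : IsReprForm μ C B q) {φ χ ψ : E → ℝ} (hφ : φ ∈ C) (hχ : χ ∈ C)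
    (hψ : ψ ∈ C) : q φ (χ + ψ) = q φ χ + q φ ψ := by
  rw [hq.repr _ hφ _ (add_mem hχ hψ), hq.repr _ hφ _ hχ, hq.repr _ hφ _ hψ, ← neg_add]
  refine congrArg Neg.neg ?_
  refine Eq.trans ?_ (integral_add ((hq.memLp_gen _ hφ).integrable_mul (hq.memLp _ hχ))
      ((hq.memLp_gen _ hφ).integrable_mul (hq.memLp _ hψ)))
  simp [mul_add]

theorem smul_right (hq : IsReprForm μ C B q) {φ χ : E → ℝ} (hφ : φ ∈ C) (hχ : χ ∈ C) (c : ℝ) :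
    q φ (c • χ) = c * q φ χ := by
  rw [hq.repr _ hφ _ (C.smul_mem hχ c), hq.repr _ hφ _ hχ, mul_neg, ← integral_const_mul]
  congr 2 with x
  simp only [Pi.smul_apply, smul_eq_mul]
  ring

theorem sub_right (hq : IsReprForm μ C B q) {φ χ ψ : E → ℝ} (hφ : φ ∈ C) (hχ : χ ∈ C)
    (hψ : ψ ∈ C) : q φ (χ - ψ) = q φ χ - q φ ψ := by
  have h := hq.smul_right hφ hψ (-1)
  rw [sub_eq_add_neg, hq.add_right hφ hχ (neg_mem hψ)]
  rw [neg_one_smul] at h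
  linarith

theorem add_left (hq : IsReprForm μ C B q) {φ χ ψ : E → ℝ} (hφ : φ ∈ C) (hχ : χ ∈ C)
    (hψ : ψ ∈ C) : q (χ + ψ) φ = q χ φ + q ψ φ := by
  rw [hq.symm _ (add_mem hχ hψ) _ hφ, hq.add_right hφ hχ hψ, hq.symm _ hφ _ hχ, hq.symm _ hφ _ hψ]

theorem sub_left (hq : IsReprForm μ C B q) {φ χ ψ : E → ℝ} (hφ : φ ∈ C) (hχ : χ ∈ C)
    (hψ : ψ ∈ C) : q (χ - ψ) φ = q χ φ - q ψ φ := by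
  rw [hq.symm _ (sub_mem hχ hψ) _ hφ, hq.sub_right hφ hχ hψ, hq.symm _ hφ _ hχ, hq.symm _ hφ _ hψ]

theorem smul_left (hq : IsReprForm μ C B q) {φ χ : E → ℝ} (hφ : φ ∈ C) (hχ : χ ∈ C) (c : ℝ) :
    q (c • χ) φ = c * q χ φ := by
  rw [hq.symm _ (C.smul_mem hχ c) _ hφ, hq.smul_right hφ hχ, hq.symm _ hφ _ hχ]

theorem add_self (hq : IsReprForm μ C B q) {φ χ : E → ℝ} (hφ : φ ∈ C) (hχ : χ ∈ C) :
    q (φ + χ) (φ + χ) = q φ φ + 2 * q φ χ + q χ χ := by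
  rw [hq.add_right (add_mem hφ hχ) hφ hχ, hq.add_left hφ hφ hχ, hq.add_left hχ hφ hχ,
    hq.symm _ hχ _ hφ]
  ring

theorem sub_self (hq : IsReprForm μ C B q) {φ χ : E → ℝ} (hφ : φ ∈ C) (hχ : χ ∈ C) :
    q (φ - χ) (φ - χ) = q φ φ - 2 * q φ χ + q χ χ := by
  rw [hq.sub_right (sub_mem hφ hχ) hφ hχ, hq.sub_left hφ hφ hχ, hq.sub_left hχ hφ hχ,
    hq.symm _ hχ _ hφ]
  ring

theorem add_self_le (hq : IsReprForm μ C B q) {φ χ : E → ℝ} (hφ : φ ∈ C) (hχ : χ ∈ C) :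
    q (φ + χ) (φ + χ) ≤ 2 * q φ φ + 2 * q χ χ := by
  have h1 := hq.add_self hφ hχ
  have h2 := hq.sub_self hφ hχ
  have h3 := hq.nonneg _ (sub_mem hφ hχ)
  linarith

theorem sub_self_le (hq : IsReprForm μ C B q) {φ χ : E → ℝ} (hφ : φ ∈ C) (hχ : χ ∈ C) :
    q (φ - χ) (φ - χ) ≤ 2 * q φ φ + 2 * q χ χ := by
  have h1 := hq.add_self hφ hχ
  have h2 := hq.sub_self hφ hχ
  have h3 := hq.nonneg _ (add_mem hφ hχ)
  linarith

theorem cauchySchwarz (hq : IsReprForm μ C B q) {φ χ : E → ℝ} (hφ : φ ∈ C) (hχ : χ ∈ C) :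
    |q φ χ| ≤ √(q φ φ) * √(q χ χ) := by
  have h : ∀ t : ℝ, 0 ≤ q χ χ * (t * t) + 2 * q φ χ * t + q φ φ := fun t => by
    have h1 := hq.nonneg _ (add_mem hφ (C.smul_mem hχ t))
    rw [hq.add_self hφ (C.smul_mem hχ t), hq.smul_right hφ hχ,
      hq.smul_right (C.smul_mem hχ t) hχ, hq.smul_left hχ hχ] at h1
    linarith
  have h2 := discrim_le_zero h
  rw [discrim] at h2
  rw [← Real.sqrt_mul (hq.nonneg _ hφ)]
  exact Real.abs_le_sqrt (by linarith)

/-- Continuity of `q` along form-Cauchy sequences. With `tendsto_of_abs_le` it gives both the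
existence of limits and their independence of the approximating sequences. -/
theorem abs_sub_le (hq : IsReprForm μ C B q) {a b a' b' : E → ℝ} (ha : a ∈ C) (hb : b ∈ C)
    (ha' : a' ∈ C) (hb' : b' ∈ C) :
    |q a b - q a' b'| ≤
      √(q (a - a') (a - a')) * √(q b b) + √(q a' a') * √(q (b - b') (b - b')) := by
  have h : q a b - q a' b' = q (a - a') b + q a' (b - b') := by
    rw [hq.sub_left hb ha ha', hq.sub_right ha' hb hb']
    ring
  rw [h]
  exact (abs_add_le _ _).trans (add_le_add (hq.cauchySchwarz (sub_mem ha ha') hb)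
    (hq.cauchySchwarz ha' (sub_mem hb hb')))

theorem isApproxSeq_const (hq : IsReprForm μ C B q) {φ : E → ℝ} (hφ : φ ∈ C) :
    IsApproxSeq μ C q (fun _ => φ) φ := by
  refine ⟨fun _ => hφ, by simp, ?_⟩
  have : q (φ - φ) (φ - φ) = 0 := by rw [hq.sub_self hφ hφ]; ring
  simp only [this]
  exact tendsto_const_nhds

theorem mem_closureDomain (hq : IsReprForm μ C B q) {φ : E → ℝ} (hφ : φ ∈ C) :
    φ ∈ closureDomain μ C q :=
  ⟨hq.memLp _ hφ, _, hq.isApproxSeq_const hφ⟩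

theorem isApproxSeq_sub (hq : IsReprForm μ C B q) {φ ψ : ℕ → E → ℝ} {u v : E → ℝ}
    (hφ : IsApproxSeq μ C q φ u) (hψ : IsApproxSeq μ C q ψ v) (hu : MemLp u 2 μ)
    (hv : MemLp v 2 μ) : IsApproxSeq μ C q (fun k => φ k - ψ k) (u - v) := by
  obtain ⟨h1, h2, h3⟩ := hφ
  obtain ⟨k1, k2, k3⟩ := hψ
  refine ⟨fun k => sub_mem (h1 k) (k1 k), ?_, ?_⟩
  · refine tendsto_of_tendsto_of_tendsto_of_le_of_le tendsto_const_nhds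
      (by simpa using h2.add k2) (fun _ => zero_le) fun k => ?_
    have : φ k - ψ k - (u - v) = (φ k - u) - (ψ k - v) := by abel
    change eLpNorm (φ k - ψ k - (u - v)) 2 μ ≤ _
    rw [this]
    exact eLpNorm_sub_le ((hq.memLp _ (h1 k)).sub hu).aestronglyMeasurable
      ((hq.memLp _ (k1 k)).sub hv).aestronglyMeasurable (by norm_num)
  · refine tendsto_of_tendsto_of_tendsto_of_le_of_le tendsto_const_nhds
      (by simpa using (h3.const_mul 2).add (k3.const_mul 2))
      (fun k => hq.nonneg _ (sub_mem (sub_mem (h1 _) (k1 _)) (sub_mem (h1 _) (k1 _)))) fun k => ?_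
    have : φ k.1 - ψ k.1 - (φ k.2 - ψ k.2) = (φ k.1 - φ k.2) - (ψ k.1 - ψ k.2) := by abel
    simp only [this]
    exact hq.sub_self_le (sub_mem (h1 _) (h1 _)) (sub_mem (k1 _) (k1 _))

theorem cauchy_of_isApproxSeq {φ : ℕ → E → ℝ} {u : E → ℝ}
    (hφ : IsApproxSeq μ C q φ u) {ε : ℝ} (hε : 0 < ε) :
    ∃ N, ∀ k ≥ N, ∀ l ≥ N, q (φ k - φ l) (φ k - φ l) < ε := by
  have h := hφ.2.2.eventually_lt_const hε
  obtain ⟨N, hN⟩ := eventually_atTop.1 h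
  exact ⟨max N.1 N.2, fun k hk l hl =>
    hN (k, l) ⟨(le_max_left _ _).trans hk, (le_max_right _ _).trans hl⟩⟩

/-- Against a fixed test function the form is an `L²` pairing, so `L²` convergence alone determines
the limit. -/
theorem tendsto_gen (hq : IsReprForm μ C B q) {φ : ℕ → E → ℝ} {u g : E → ℝ} (hg : g ∈ C)
    (hφ : IsApproxSeq μ C q φ u) (hu : MemLp u 2 μ) :
    Tendsto (fun k => q (φ k) g) atTop (𝓝 (-∫ x, B g x * u x ∂μ)) := by
  have h := (tendsto_integral_mul_of_tendsto_eLpNorm (fun k => hq.memLp _ (hφ.1 k)) hu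
    (hq.memLp_gen _ hg) hφ.2.1).neg
  refine h.congr fun k => ?_
  rw [hq.symm _ (hφ.1 k) _ hg, hq.repr _ hg _ (hφ.1 k)]

/-- Expand `q (φ k - φ l) (φ k - φ l)`: for large `k` and `l` the energy of `φ k` is at most `ε / 2
+ 2 * q (φ l) (φ k)`. With `k` fixed the cross term vanishes as `l` grows, by `tendsto_gen` with
limit function zero. -/
theorem closable (hq : IsReprForm μ C B q) {φ : ℕ → E → ℝ} (hφ : IsApproxSeq μ C q φ 0) :
    Tendsto (fun k => q (φ k) (φ k)) atTop (𝓝 0) := by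
  rw [Metric.tendsto_atTop]
  intro ε hε
  obtain ⟨N, hN⟩ := cauchy_of_isApproxSeq hφ (half_pos hε)
  refine ⟨N, fun k hk => ?_⟩
  rw [Real.dist_eq, sub_zero, abs_of_nonneg (hq.nonneg _ (hφ.1 k))]
  have h1 := (hq.tendsto_gen (hφ.1 k) hφ MemLp.zero').const_mul 2 |>.const_add (ε / 2)
  simp only [Pi.zero_apply, mul_zero, integral_zero, neg_zero, add_zero] at h1
  refine lt_of_le_of_lt (ge_of_tendsto h1 ?_) (half_lt_self hε)
  filter_upwards [eventually_ge_atTop N] with l hl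
  have h2 := hq.sub_self (hφ.1 k) (hφ.1 l)
  have h3 := hN k hk l hl
  have h4 := hq.nonneg _ (hφ.1 l)
  rw [hq.symm _ (hφ.1 l) _ (hφ.1 k)]
  linarith

theorem exists_bound (hq : IsReprForm μ C B q) {φ : ℕ → E → ℝ} {u : E → ℝ}
    (hφ : IsApproxSeq μ C q φ u) : ∃ M, 0 ≤ M ∧ ∀ᶠ k in atTop, √(q (φ k) (φ k)) ≤ M := by
  obtain ⟨N, hN⟩ := cauchy_of_isApproxSeq hφ one_pos
  refine ⟨√(2 * 1 + 2 * q (φ N) (φ N)), by positivity, ?_⟩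
  filter_upwards [eventually_ge_atTop N] with k hk
  refine Real.sqrt_le_sqrt ?_
  have h := hq.add_self_le (sub_mem (hφ.1 k) (hφ.1 N)) (hφ.1 N)
  rw [sub_add_cancel] at h
  linarith [hN k hk N le_rfl]

theorem tendsto_of_abs_le {ι : Type*} {l : Filter ι} {x a b c d : ι → ℝ} {M M' : ℝ}
    (h : ∀ᶠ i in l, |x i| ≤ √(a i) * c i + d i * √(b i))
    (ha : Tendsto a l (𝓝 0)) (hb : Tendsto b l (𝓝 0))
    (hc : ∀ᶠ i in l, c i ≤ M) (hd : ∀ᶠ i in l, d i ≤ M') : Tendsto x l (𝓝 0) := by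
  have h1 : Tendsto (fun i => √(a i) * M + M' * √(b i)) l (𝓝 0) := by
    simpa using (ha.sqrt.mul_const M).add (hb.sqrt.const_mul M')
  refine squeeze_zero_norm' ?_ h1
  filter_upwards [h, hc, hd] with i h hc hd
  exact h.trans (add_le_add (mul_le_mul_of_nonneg_left hc (Real.sqrt_nonneg _))
    (mul_le_mul_of_nonneg_right hd (Real.sqrt_nonneg _)))

theorem exists_tendsto (hq : IsReprForm μ C B q) {φ ψ : ℕ → E → ℝ} {u v : E → ℝ}
    (hφ : IsApproxSeq μ C q φ u) (hψ : IsApproxSeq μ C q ψ v) :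
    ∃ r, Tendsto (fun k => q (φ k) (ψ k)) atTop (𝓝 r) := by
  refine cauchySeq_tendsto_of_complete (cauchySeq_iff_tendsto_dist_atTop_0.2 ?_)
  obtain ⟨M, -, hM⟩ := hq.exists_bound hφ
  obtain ⟨M', -, hM'⟩ := hq.exists_bound hψ
  have f1 : Tendsto (Prod.fst : ℕ × ℕ → ℕ) atTop atTop := prod_atTop_atTop_eq (α := ℕ) (β := ℕ) ▸ tendsto_fst
  have f2 : Tendsto (Prod.snd : ℕ × ℕ → ℕ) atTop atTop := prod_atTop_atTop_eq (α := ℕ) (β := ℕ) ▸ tendsto_snd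
  exact tendsto_of_abs_le (Eventually.of_forall fun k => by
    rw [Real.dist_eq, abs_abs]
    exact hq.abs_sub_le (hφ.1 k.1) (hψ.1 k.1) (hφ.1 k.2) (hψ.1 k.2))
    hφ.2.2 hψ.2.2 (f1.eventually hM') (f2.eventually hM)

/-- The closed form may be computed along any pair of approximating sequences. -/
theorem tendsto_closureForm (hq : IsReprForm μ C B q) {φ ψ : ℕ → E → ℝ} {u v : E → ℝ}
    (hu : MemLp u 2 μ) (hv : MemLp v 2 μ)
    (hφ : IsApproxSeq μ C q φ u) (hψ : IsApproxSeq μ C q ψ v) :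
    Tendsto (fun k => q (φ k) (ψ k)) atTop (𝓝 (closureForm μ C q u v)) := by
  obtain ⟨r, hr⟩ := hq.exists_tendsto hφ hψ
  have hex : ∃ r : ℝ, ∃ φ ψ : ℕ → E → ℝ, IsApproxSeq μ C q φ u ∧ IsApproxSeq μ C q ψ v ∧
      Tendsto (fun k => q (φ k) (ψ k)) atTop (𝓝 r) := ⟨r, φ, ψ, hφ, hψ, hr⟩
  rw [closureForm, dif_pos hex]
  obtain ⟨φ', ψ', hφ', hψ', h'⟩ := hex.choose_spec
  -- The difference of two approximating sequences of one function approximates zero, so closability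
  -- kills its energy.
  have e1 := hq.isApproxSeq_sub hφ hφ' hu hu
  have e2 := hq.isApproxSeq_sub hψ hψ' hv hv
  rw [_root_.sub_self] at e1 e2
  obtain ⟨M, -, hM⟩ := hq.exists_bound hφ'
  obtain ⟨M', -, hM'⟩ := hq.exists_bound hψ
  have h0 : Tendsto (fun k => q (φ k) (ψ k) - q (φ' k) (ψ' k)) atTop (𝓝 0) :=
    tendsto_of_abs_le (Eventually.of_forall fun k =>
      hq.abs_sub_le (hφ.1 k) (hψ.1 k) (hφ'.1 k) (hψ'.1 k)) (hq.closable e1) (hq.closable e2) hM' hM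
  simpa using h0.add h'

/-- Approximate `g` by the constant sequence. This formula turns the square field identity into an
identity between `L²` pairings. -/
theorem closureForm_eq (hq : IsReprForm μ C B q) {u g : E → ℝ} (hg : g ∈ C)
    (hu : u ∈ closureDomain μ C q) : closureForm μ C q u g = -∫ x, B g x * u x ∂μ := by
  obtain ⟨hu, φ, hφ⟩ := hu
  exact tendsto_nhds_unique
    (hq.tendsto_closureForm hu (hq.memLp _ hg) hφ (hq.isApproxSeq_const hg))
    (hq.tendsto_gen hg hφ hu)

/-- The infimum of `q` over the convex hulls of the tails provides a Cauchy sequence. -/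
theorem mem_closureDomain_of_bounded (hq : IsReprForm μ C B q) {u : ℕ → E → ℝ} {v : E → ℝ} {M : ℝ}
    (hv : MemLp v 2 μ) (hu : ∀ k, u k ∈ C) (hM : ∀ k, q (u k) (u k) ≤ M)
    (huv : Tendsto (fun k => eLpNorm (u k - v) 2 μ) atTop (𝓝 0)) : v ∈ closureDomain μ C q := by
  set K : ℕ → Set (E → ℝ) := fun k => convexHull ℝ (u '' Set.Ici k)
  have hKC : ∀ k, ∀ w ∈ K k, w ∈ C := fun k =>
    convexHull_min (by rintro _ ⟨j, -, rfl⟩; exact hu j) C.toSubmodule.convex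
  have hanti : ∀ k l, k ≤ l → K l ⊆ K k := fun k l h =>
    convexHull_mono (Set.image_mono (Set.Ici_subset_Ici.2 h))
  have huK : ∀ k, u k ∈ K k := fun k => subset_convexHull _ _ ⟨k, Set.mem_Ici.2 le_rfl, rfl⟩
  have hbdd : ∀ k, BddBelow ((fun w => q w w) '' K k) := fun k =>
    ⟨0, by rintro _ ⟨w, hw, rfl⟩; exact hq.nonneg _ (hKC k w hw)⟩
  set m : ℕ → ℝ := fun k => sInf ((fun w => q w w) '' K k)
  have hne : ∀ k, ((fun w => q w w) '' K k).Nonempty := fun k => ⟨_, _, huK k, rfl⟩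
  have hmono : Monotone m := fun k l h =>
    csInf_le_csInf (hbdd k) (hne l) (Set.image_mono (hanti k l h))
  have hmM : ∀ k, m k ≤ M := fun k => (csInf_le (hbdd k) ⟨_, huK k, rfl⟩).trans (hM k)
  have hmlim := tendsto_atTop_ciSup hmono ⟨M, by rintro _ ⟨k, rfl⟩; exact hmM k⟩
  set s := ⨆ k, m k
  have hch : ∀ k : ℕ, ∃ w ∈ K k, q w w < m k + 1 / (k + 1) := fun k => by
    obtain ⟨_, ⟨w, hw, rfl⟩, h⟩ := exists_lt_of_csInf_lt (hne k)
      (lt_add_of_pos_right (m k) (Nat.one_div_pos_of_nat (n := k)))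
    exact ⟨w, hw, h⟩
  choose w hwK hw using hch
  refine ⟨hv, w, fun k => hKC k _ (hwK k), ?_, ?_⟩
  · rw [ENNReal.tendsto_nhds_zero] at huv ⊢
    intro ε hε
    obtain ⟨N, hN⟩ := eventually_atTop.1 (huv ε hε)
    filter_upwards [eventually_ge_atTop N] with k hk
    -- `L²` balls are convex, so convex combinations of the tail converge to `v` too. Membership in
    -- `L²` is part of `S` because the triangle inequality for `eLpNorm` needs measurability.
    set S : Set (E → ℝ) := {f | MemLp f 2 μ ∧ eLpNorm (f - v) 2 μ ≤ ε}
    have hS : Convex ℝ S := by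
      intro f hf g hg a b ha hb hab
      refine ⟨(hf.1.const_smul a).add (hg.1.const_smul b), ?_⟩
      have : a • f + b • g - v = a • (f - v) + b • (g - v) := by
        have : v = (a + b) • v := by rw [hab, one_smul]
        nth_rewrite 1 [this]
        module
      rw [this]
      refine (eLpNorm_add_le ((hf.1.sub hv).const_smul a).aestronglyMeasurable
        ((hg.1.sub hv).const_smul b).aestronglyMeasurable (by norm_num)).trans ?_
      rw [eLpNorm_const_smul, eLpNorm_const_smul, Real.enorm_of_nonneg ha, Real.enorm_of_nonneg hb]
      calc _ ≤ ENNReal.ofReal a * ε + ENNReal.ofReal b * ε := by gcongr; exacts [hf.2, hg.2]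
        _ = ε := by rw [← add_mul, ← ENNReal.ofReal_add ha hb, hab]; simp
    have hsub : K k ⊆ S := convexHull_min (by
      rintro _ ⟨j, hj, rfl⟩
      exact ⟨hq.memLp _ (hu j), hN j (hk.trans hj)⟩) hS
    exact (hsub (hwK k)).2
  · have f1 : Tendsto (Prod.fst : ℕ × ℕ → ℕ) atTop atTop := prod_atTop_atTop_eq (α := ℕ) (β := ℕ) ▸ tendsto_fst
    have f2 : Tendsto (Prod.snd : ℕ × ℕ → ℕ) atTop atTop := prod_atTop_atTop_eq (α := ℕ) (β := ℕ) ▸ tendsto_snd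
    have f3 : Tendsto (fun k : ℕ × ℕ => min k.1 k.2) atTop atTop := by
      rw [tendsto_atTop]
      intro b
      filter_upwards [f1.eventually_ge_atTop b, f2.eventually_ge_atTop b] with k h1 h2
      exact le_min h1 h2
    have g : Tendsto (fun k : ℕ => m k + 1 / ((k : ℝ) + 1)) atTop (𝓝 (s + 0)) :=
      hmlim.add tendsto_one_div_add_atTop_nhds_zero_nat
    have hlim : Tendsto (fun k : ℕ × ℕ => 2 * (m k.1 + 1 / ((k.1 : ℝ) + 1)) +
        2 * (m k.2 + 1 / ((k.2 : ℝ) + 1)) - 4 * m (min k.1 k.2)) atTop (𝓝 0) := by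
      have h := (((g.comp f1).const_mul 2).add ((g.comp f2).const_mul 2)).sub
        ((hmlim.comp f3).const_mul 4)
      have h0 : 2 * (s + 0) + 2 * (s + 0) - 4 * s = 0 := by ring
      rw [h0] at h
      exact h
    refine tendsto_of_tendsto_of_tendsto_of_le_of_le tendsto_const_nhds hlim
      (fun k => hq.nonneg _ (sub_mem (hKC _ _ (hwK _)) (hKC _ _ (hwK _)))) fun k => ?_
    have c1 := hKC _ _ (hwK k.1)
    have c2 := hKC _ _ (hwK k.2)
    -- Parallelogram law: the midpoint lies in the hull of the longer tail, so its energy is at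
    -- least `m (min k.1 k.2)`. As `w k` almost realises `m k` and `m` converges, the energy of the
    -- difference tends to zero.
    have hmid : (1 / 2 : ℝ) • (w k.1 + w k.2) ∈ K (min k.1 k.2) := by
      rw [smul_add]
      exact convex_convexHull ℝ _ (hanti _ _ (min_le_left _ _) (hwK k.1))
        (hanti _ _ (min_le_right _ _) (hwK k.2)) (by norm_num) (by norm_num) (by norm_num)
    have h1 : m (min k.1 k.2) ≤ _ := csInf_le (hbdd _) ⟨_, hmid, rfl⟩
    simp only at h1
    rw [hq.smul_right (C.smul_mem (add_mem c1 c2) _) (add_mem c1 c2),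
      hq.smul_left (add_mem c1 c2) (add_mem c1 c2), hq.add_self c1 c2] at h1
    simp only [hq.sub_self c1 c2]
    have h2 := hw k.1
    have h3 := hw k.2
    linarith

end IsReprForm

end ErrorCalculus

/-! ### Polynomial approximation, bounded measurable functions, and limits of squared increments -/

namespace ErrorCalculus

theorem exists_polynomial_derivative_eq (p : Polynomial ℝ) :
    ∃ P : Polynomial ℝ, P.derivative = p := by
  induction p using Polynomial.induction_on' with
  | add p r hp hr =>
    obtain ⟨P, rfl⟩ := hp
    obtain ⟨R, rfl⟩ := hr
    exact ⟨P + R, Polynomial.derivative_add⟩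
  | monomial n a =>
    refine ⟨Polynomial.monomial (n + 1) (a / (n + 1)), ?_⟩
    rw [Polynomial.derivative_monomial]
    congr 1
    push_cast
    field_simp

/-- Weierstrass approximation in `C¹` norm on a bounded interval. -/
theorem exists_polynomial_near_of_hasDerivAt {F F' : ℝ → ℝ} (hF : ∀ x, HasDerivAt F (F' x) x)
    (hF' : Continuous F') (c : ℝ) {ε : ℝ} (hε : 0 < ε) :
    ∃ P : Polynomial ℝ, ∀ x, |x| ≤ c → |P.eval x - F x| ≤ ε ∧
      ∀ y, |y| ≤ c → |P.eval y - P.eval x - (F y - F x)| ≤ ε * |y - x| := by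
  by_cases hc : 0 ≤ c
  swap
  · exact ⟨0, fun x hx => absurd ((abs_nonneg x).trans hx) hc⟩
  -- Approximate the derivative and take a primitive. The divisor `c + 1` keeps the error
  -- accumulated from `0` to `x` below `ε`; the constant added to `P` below matches the values at
  -- `0`.
  obtain ⟨p, hp⟩ := exists_polynomial_near_of_continuousOn (-c) c F' hF'.continuousOn (ε / (c + 1))
    (by positivity)
  obtain ⟨P, rfl⟩ := exists_polynomial_derivative_eq p
  have hd : ∀ x, HasDerivAt (fun x => P.eval x - F x) (P.derivative.eval x - F' x) x :=
    fun x => (P.hasDerivAt x).sub (hF x)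
  have hlip : ∀ x, |x| ≤ c → ∀ y, |y| ≤ c →
      |P.eval y - F y - (P.eval x - F x)| ≤ ε / (c + 1) * |y - x| := fun x hx y hy =>
    (convex_Icc (-c) c).norm_image_sub_le_of_norm_hasDerivWithin_le
      (fun z _ => (hd z).hasDerivWithinAt) (fun z hz => (hp z hz).le) (abs_le.1 hx) (abs_le.1 hy)
  have hle : ε / (c + 1) ≤ ε := div_le_self hε.le (by linarith)
  refine ⟨P + Polynomial.C (F 0 - P.eval 0), fun x hx => ⟨?_, fun y hy => ?_⟩⟩
  · have h := hlip 0 (by simpa using hc) x hx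
    rw [Polynomial.eval_add, Polynomial.eval_C]
    calc |P.eval x + (F 0 - P.eval 0) - F x| = |P.eval x - F x - (P.eval 0 - F 0)| := by
          congr 1; ring
      _ ≤ ε / (c + 1) * |x - 0| := h
      _ ≤ ε / (c + 1) * (c + 1) := by
          rw [sub_zero]; gcongr; linarith
      _ = ε := by field_simp
  · have h := (hlip x hx y hy).trans (mul_le_mul_of_nonneg_right hle (abs_nonneg _))
    rw [Polynomial.eval_add, Polynomial.eval_C, Polynomial.eval_add, Polynomial.eval_C]
    refine le_trans (le_of_eq ?_) h
    congr 1; ring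

/-- Interchange of limits: a sequence uniformly approximated by convergent sequences converges. -/
theorem tendsto_of_uniform_approx {a : ℕ → ℝ} {r : ℝ}
    (h : ∀ ε > 0, ∃ (b : ℕ → ℝ) (s : ℝ), (∀ n, |a n - b n| ≤ ε) ∧ Tendsto b atTop (𝓝 s) ∧
      |s - r| ≤ ε) : Tendsto a atTop (𝓝 r) := by
  rw [Metric.tendsto_atTop]
  intro ε hε
  obtain ⟨b, s, h1, h2, h3⟩ := h (ε / 4) (by positivity)
  obtain ⟨N, hN⟩ := Metric.tendsto_atTop.1 h2 (ε / 4) (by positivity)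
  refine ⟨N, fun n hn => ?_⟩
  have h4 := hN n hn
  have h5 := h1 n
  rw [Real.dist_eq] at h4 ⊢
  rw [abs_le] at h3 h5
  rw [abs_lt] at h4 ⊢
  constructor <;> linarith

/-- Bounded measurable real functions. -/
def IsBddMeas {X : Type*} [MeasurableSpace X] (f : X → ℝ) : Prop :=
  Measurable f ∧ ∃ c, ∀ x, |f x| ≤ c

namespace IsBddMeas

variable {X Z : Type*} [MeasurableSpace X] [MeasurableSpace Z] {f g : X → ℝ}

theorem const (c : ℝ) : IsBddMeas fun _ : X => c := ⟨measurable_const, |c|, fun _ => le_rfl⟩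

theorem add (hf : IsBddMeas f) (hg : IsBddMeas g) : IsBddMeas fun x => f x + g x := by
  obtain ⟨hf, c, hc⟩ := hf
  obtain ⟨hg, d, hd⟩ := hg
  exact ⟨hf.add hg, c + d, fun x => (abs_add_le _ _).trans (add_le_add (hc x) (hd x))⟩

theorem sub (hf : IsBddMeas f) (hg : IsBddMeas g) : IsBddMeas fun x => f x - g x := by
  obtain ⟨hf, c, hc⟩ := hf
  obtain ⟨hg, d, hd⟩ := hg
  exact ⟨hf.sub hg, c + d, fun x => (abs_sub _ _).trans (add_le_add (hc x) (hd x))⟩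

theorem mul (hf : IsBddMeas f) (hg : IsBddMeas g) : IsBddMeas fun x => f x * g x := by
  obtain ⟨hf, c, hc⟩ := hf
  obtain ⟨hg, d, hd⟩ := hg
  refine ⟨hf.mul hg, c * d, fun x => ?_⟩
  rw [abs_mul]
  exact mul_le_mul (hc x) (hd x) (abs_nonneg _) ((abs_nonneg _).trans (hc x))

theorem sq (hf : IsBddMeas f) : IsBddMeas fun x => f x ^ 2 := by
  simpa only [pow_two] using hf.mul hf

theorem abs (hf : IsBddMeas f) : IsBddMeas fun x => |f x| := by
  obtain ⟨hf, c, hc⟩ := hf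
  exact ⟨continuous_abs.measurable.comp hf, c, fun x => by simpa using hc x⟩

theorem comp (hf : IsBddMeas f) {T : Z → X} (hT : Measurable T) : IsBddMeas fun z => f (T z) := by
  obtain ⟨hf, c, hc⟩ := hf
  exact ⟨hf.comp hT, c, fun x => hc _⟩

theorem sum {ι : Type*} {F : ι → X → ℝ} (s : Finset ι) (h : ∀ i ∈ s, IsBddMeas (F i)) :
    IsBddMeas fun x => ∑ i ∈ s, F i x := by
  classical
  induction s using Finset.induction_on with
  | empty => simpa using const 0
  | insert i s hi ih =>
    simp only [Finset.sum_insert hi]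
    exact (h i (Finset.mem_insert_self _ _)).add (ih fun j hj => h j (Finset.mem_insert_of_mem hj))

theorem exists_common_bound {ι : Type*} [Fintype ι] {F : ι → X → ℝ} (h : ∀ i, IsBddMeas (F i)) :
    ∃ c, 0 ≤ c ∧ ∀ i x, |F i x| ≤ c := by
  choose c hc using fun i => (h i).2
  refine ⟨∑ i, |c i|, Finset.sum_nonneg fun i _ => abs_nonneg _, fun i x => ?_⟩
  exact ((hc i x).trans (le_abs_self _)).trans
    (Finset.single_le_sum (f := fun i => |c i|) (fun i _ => abs_nonneg _) (Finset.mem_univ i))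

/-- A continuous function of finitely many bounded measurable functions. -/
theorem continuous_comp {ι : Type*} [Fintype ι] {F : ι → X → ℝ} (h : ∀ i, IsBddMeas (F i))
    {G : (ι → ℝ) → ℝ} (hG : Continuous G) : IsBddMeas fun x => G fun i => F i x := by
  obtain ⟨c, hc0, hc⟩ := exists_common_bound h
  obtain ⟨d, hd⟩ := (isCompact_closedBall (0 : ι → ℝ) c).exists_bound_of_continuousOn hG.continuousOn
  refine ⟨hG.measurable.comp (measurable_pi_lambda _ fun i => (h i).1), d, fun x => hd _ ?_⟩
  rw [mem_closedBall_zero_iff, pi_norm_le_iff_of_nonneg hc0]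
  exact fun i => hc i x

theorem continuous_comp_one (hf : IsBddMeas f) {G : ℝ → ℝ} (hG : Continuous G) :
    IsBddMeas fun x => G (f x) := by
  obtain ⟨hf, c, hc⟩ := hf
  obtain ⟨d, hd⟩ := (isCompact_Icc (a := -c) (b := c)).exists_bound_of_continuousOn hG.continuousOn
  exact ⟨hG.measurable.comp hf, d, fun x => hd _ (abs_le.1 (hc x))⟩

theorem memLp (hf : IsBddMeas f) (μ : Measure X) [IsFiniteMeasure μ] (p : ENNReal) :
    MemLp f p μ := by
  obtain ⟨hf, c, hc⟩ := hf
  exact MemLp.of_bound hf.aestronglyMeasurable c (Eventually.of_forall hc)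

theorem integrable (hf : IsBddMeas f) (μ : Measure X) [IsFiniteMeasure μ] : Integrable f μ :=
  memLp_one_iff_integrable.1 (hf.memLp μ 1)

end IsBddMeas

/-- The increment of a function between the two points of a pair. -/
def incr {E : Type*} (φ : E → ℝ) (z : E × E) : ℝ := φ z.2 - φ z.1

theorem IsBddMeas.incr {E : Type*} [MeasurableSpace E] {φ : E → ℝ} (h : IsBddMeas φ) :
    IsBddMeas (ErrorCalculus.incr φ) :=
  (h.comp measurable_snd).sub (h.comp measurable_fst)

/-- The form `q` on an algebra `C` of bounded functions is the limit of the squared increments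
under the finite measures `ν n` on pairs, and is represented by the operator `-B`. -/
structure IsBiasForm {E : Type*} [MeasurableSpace E] (ν : ℕ → Measure (E × E)) (μ : Measure E)
    (C : Subalgebra ℝ (E → ℝ)) (B : (E → ℝ) → E → ℝ) (q : (E → ℝ) → (E → ℝ) → ℝ) : Prop where
  bddMeas : ∀ φ ∈ C, IsBddMeas φ
  memLp_gen : ∀ φ ∈ C, MemLp (B φ) 2 μ
  repr : ∀ φ ∈ C, ∀ χ ∈ C, q φ χ = -∫ x, B φ x * χ x ∂μ
  lim : ∀ φ ∈ C, ∀ χ ∈ C,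
    Tendsto (fun n => ∫ z, incr φ z * incr χ z ∂(ν n)) atTop (𝓝 (2 * q φ χ))

variable {E : Type*} [MeasurableSpace E] {ν : ℕ → Measure (E × E)} {μ : Measure E}
  [IsFiniteMeasure μ]
  {C : Subalgebra ℝ (E → ℝ)} {B : (E → ℝ) → E → ℝ} {q : (E → ℝ) → (E → ℝ) → ℝ}

namespace IsBiasForm

theorem isReprForm (hq : IsBiasForm ν μ C B q) : IsReprForm μ C B q where
  memLp φ hφ := (hq.bddMeas φ hφ).memLp μ 2
  memLp_gen := hq.memLp_gen
  repr := hq.repr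
  symm φ hφ χ hχ := by
    have h := tendsto_nhds_unique (hq.lim φ hφ χ hχ)
      ((hq.lim χ hχ φ hφ).congr fun n => by simp only [mul_comm])
    linarith
  nonneg φ hφ := by
    have h := ge_of_tendsto' (hq.lim φ hφ φ hφ) fun n => integral_nonneg fun z => mul_self_nonneg _
    linarith

end IsBiasForm
end ErrorCalculus

/-! ### Energy comparison, products in the domain, and the square field identity -/

namespace ErrorCalculus

variable {E : Type*} [MeasurableSpace E] {ν : ℕ → Measure (E × E)} {μ : Measure E}
  {C : Subalgebra ℝ (E → ℝ)} {B : (E → ℝ) → E → ℝ} {q : (E → ℝ) → (E → ℝ) → ℝ}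

theorem eval_mem_subalgebra {X : Type*} {C : Subalgebra ℝ (X → ℝ)} {f : X → ℝ} (hf : f ∈ C)
    (P : Polynomial ℝ) : (fun x => P.eval (f x)) ∈ C := by
  have h : Polynomial.aeval f P = fun x => P.eval (f x) := by
    ext x
    rw [Polynomial.aeval_def, Polynomial.eval₂_eq_sum_range, Polynomial.eval_eq_sum_range]
    simp [Finset.sum_apply, Algebra.algebraMap_eq_smul_one]
  rw [← h]
  exact Algebra.adjoin_le (Set.singleton_subset_iff.2 hf)
    (Polynomial.aeval_mem_adjoin_singleton ℝ f)

namespace IsBiasForm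

/-- Pointwise comparison of squared increments survives the limit in `n`. This plays the role of the
contraction property for the form. -/
theorem form_le_of_incr_sq_le [∀ n, IsFiniteMeasure (ν n)] (hq : IsBiasForm ν μ C B q) {φ χ ψ : E → ℝ} (hφ : φ ∈ C)
    (hχ : χ ∈ C) (hψ : ψ ∈ C) {a b : ℝ}
    (h : ∀ z, incr φ z ^ 2 ≤ a * incr χ z ^ 2 + b * incr ψ z ^ 2) :
    q φ φ ≤ a * q χ χ + b * q ψ ψ := by
  have h1 := hq.lim φ hφ φ hφ
  have h2 := ((hq.lim χ hχ χ hχ).const_mul a).add ((hq.lim ψ hψ ψ hψ).const_mul b)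
  have i : ∀ u ∈ C, ∀ n, Integrable (fun z => incr u z * incr u z) (ν n) := fun u hu n =>
    ((hq.bddMeas u hu).incr.mul (hq.bddMeas u hu).incr).integrable _
  have h3 := le_of_tendsto_of_tendsto' h1 h2 fun n => by
    rw [← integral_const_mul, ← integral_const_mul,
      ← integral_add ((i χ hχ n).const_mul a) ((i ψ hψ n).const_mul b)]
    refine integral_mono (i φ hφ n) (((i χ hχ n).const_mul a).add ((i ψ hψ n).const_mul b))
      fun z => ?_
    simpa only [pow_two] using h z
  linarith

theorem form_le_of_abs_incr_le [∀ n, IsFiniteMeasure (ν n)] (hq : IsBiasForm ν μ C B q) {φ χ : E → ℝ} (hφ : φ ∈ C)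
    (hχ : χ ∈ C) {L : ℝ} (h : ∀ z, |incr φ z| ≤ L * |incr χ z|) : q φ φ ≤ L ^ 2 * q χ χ := by
  have := hq.form_le_of_incr_sq_le hφ hχ hχ (a := L ^ 2) (b := 0) fun z => by
    rw [zero_mul, add_zero, ← sq_abs (incr φ z), ← sq_abs (incr χ z), ← mul_pow]
    exact pow_le_pow_left₀ (abs_nonneg _) (h z) 2
  simpa using this

theorem exists_energy_bound (hq : IsBiasForm ν μ C B q) {f : E → ℝ} (hf : f ∈ C) :
    ∃ M, 0 ≤ M ∧ ∀ n, ∫ z, incr f z ^ 2 ∂(ν n) ≤ M := by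
  obtain ⟨M, hM⟩ := (hq.lim f hf f hf).bddAbove_range
  have h : ∀ n, ∫ z, incr f z ^ 2 ∂(ν n) ≤ M := fun n => by
    simpa only [pow_two] using hM ⟨n, rfl⟩
  exact ⟨M, (integral_nonneg fun z => sq_nonneg _).trans (h 0), h⟩

/-- A bounded element of the domain multiplied by a test function stays in the domain. -/
theorem mul_mem_closureDomain [∀ n, IsFiniteMeasure (ν n)] [IsFiniteMeasure μ] (hq : IsBiasForm ν μ C B q) {f h : E → ℝ} (hf : f ∈ C)
    (hh : h ∈ closureDomain μ C q) (hb : MemLp h ⊤ μ) : f * h ∈ closureDomain μ C q := by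
  obtain ⟨h2, φ, hφ⟩ := hh
  obtain ⟨hfm, c, hc⟩ := hq.bddMeas f hf
  obtain ⟨M, hM⟩ : ∃ M : ℝ, ∀ᵐ x ∂μ, |h x| ≤ M := by
    refine ⟨(eLpNorm h ⊤ μ).toReal, ?_⟩
    filter_upwards [ae_le_eLpNormEssSup (f := h) (μ := μ)] with x hx
    rw [← eLpNorm_exponent_top] at hx
    have := ENNReal.toReal_mono hb.eLpNorm_ne_top hx
    simpa using this
  -- The truncation `T x = x * b x` is the identity on `[-M, M]`, bounded and Lipschitz; `|M| + 1`
  -- keeps the inner radius positive. Since `C` is only an algebra, `T ∘ φ k` is replaced below by a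
  -- polynomial in `φ k`, close to it in `C¹`.
  let b : ContDiffBump (0 : ℝ) := ⟨|M| + 1, |M| + 2, by positivity, by linarith⟩
  have hbid : ∀ x, |x| ≤ M → b x = 1 := fun x hx => b.one_of_mem_closedBall <| by
    rw [mem_closedBall_zero_iff, Real.norm_eq_abs]
    exact hx.trans ((le_abs_self M).trans (by simp [b]))
  set T : ℝ → ℝ := fun x => x * b x
  have hTs : ContDiff ℝ ∞ T := contDiff_id.mul b.contDiff
  have hTc : HasCompactSupport T := b.hasCompactSupport.mul_left
  obtain ⟨L, hL⟩ := ContDiff.lipschitzWith_of_hasCompactSupport hTc hTs (by simp)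
  obtain ⟨R, hR⟩ := hTc.exists_bound_of_continuous hTs.continuous
  have hR0 : 0 ≤ R := (norm_nonneg _).trans (hR 0)
  have hTl : ∀ x y, |T y - T x| ≤ L * |y - x| := fun x y => by
    simpa [Real.dist_eq] using hL.dist_le_mul y x
  have hP : ∀ k : ℕ, ∃ P : Polynomial ℝ, ∀ x, |P.eval (φ k x) - T (φ k x)| ≤ 1 / (k + 1) ∧
      ∀ y, |P.eval (φ k y) - P.eval (φ k x) - (T (φ k y) - T (φ k x))|
        ≤ 1 / (k + 1) * |φ k y - φ k x| := fun k => by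
    obtain ⟨ck, hck⟩ := (hq.bddMeas _ (hφ.1 k)).2
    obtain ⟨P, hP⟩ := exists_polynomial_near_of_hasDerivAt
      (fun x => (hTs.differentiable (by simp) x).hasDerivAt)
      (hTs.continuous_deriv (by simp)) ck (Nat.one_div_pos_of_nat (n := k))
    exact ⟨P, fun x => ⟨(hP _ (hck x)).1, fun y => (hP _ (hck x)).2 _ (hck y)⟩⟩
  choose P hP using hP
  have hk1 : ∀ k : ℕ, (1 : ℝ) / (k + 1) ≤ 1 := fun k => by
    rw [div_le_one (by positivity)]; linarith [Nat.cast_nonneg (α := ℝ) k]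
  set w : ℕ → E → ℝ := fun k x => (P k).eval (φ k x)
  have hw : ∀ k, w k ∈ C := fun k => eval_mem_subalgebra (hφ.1 k) (P k)
  have hwb : ∀ k x, |w k x| ≤ R + 1 := fun k x => by
    have h1 := abs_le.1 ((hP k x).1.trans (hk1 k))
    have h2 := abs_le.1 (hR (φ k x))
    exact abs_le.2 ⟨by simp only [w]; linarith, by simp only [w]; linarith⟩
  have hwi : ∀ k z, |incr (w k) z| ≤ (L + 1) * |incr (φ k) z| := fun k z => by
    have h1 := ((hP k z.1).2 z.2).trans (mul_le_mul_of_nonneg_right (hk1 k) (abs_nonneg _))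
    have h2 := hTl (φ k z.1) (φ k z.2)
    have h3 := abs_add_le (w k z.2 - w k z.1 - (T (φ k z.2) - T (φ k z.1)))
      (T (φ k z.2) - T (φ k z.1))
    rw [sub_add_cancel] at h3
    simp only [incr]
    linarith
  have hc0 : ∀ x : E, 0 ≤ c := fun x => (abs_nonneg _).trans (hc x)
  obtain ⟨r, hr⟩ := hq.isReprForm.exists_tendsto hφ hφ
  obtain ⟨M', hM'⟩ := hr.bddAbove_range
  -- The energy bound comes from the Leibniz rule for increments and `(s + t)² ≤ 2s² + 2t²`, with
  -- `c` bounding `f`, `R + 1` bounding `w k`, and `M'` bounding the energies of `φ k`.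
  refine hq.isReprForm.mem_closureDomain_of_bounded (u := fun k => f * w k)
    (M := 2 * c ^ 2 * (L + 1) ^ 2 * M' + 2 * (R + 1) ^ 2 * q f f) ?_
    (fun k => mul_mem hf (hw k)) (fun k => ?_) ?_
  · exact h2.mul ((hq.bddMeas f hf).memLp μ ⊤)
  · have h1 := hq.form_le_of_incr_sq_le (mul_mem hf (hw k)) (hφ.1 k) hf
      (a := 2 * c ^ 2 * (L + 1) ^ 2) (b := 2 * (R + 1) ^ 2) fun z => by
      have e : incr (f * w k) z = f z.2 * incr (w k) z + w k z.1 * incr f z := by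
        simp only [incr, Pi.mul_apply]; ring
      have e1 : (f z.2 * incr (w k) z) ^ 2 ≤ c ^ 2 * ((L + 1) ^ 2 * incr (φ k) z ^ 2) := by
        rw [mul_pow, ← sq_abs (f z.2), ← sq_abs (incr (w k) z), ← sq_abs (incr (φ k) z),
          ← mul_pow (_ + 1 : ℝ)]
        gcongr
        · exact hc _
        · exact hwi k z
      have e2 : (w k z.1 * incr f z) ^ 2 ≤ (R + 1) ^ 2 * incr f z ^ 2 := by
        rw [mul_pow, ← sq_abs (w k z.1)]
        gcongr
        exact hwb k _
      rw [e]
      nlinarith [sq_nonneg (f z.2 * incr (w k) z - w k z.1 * incr f z)]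
    refine h1.trans ?_
    gcongr
    exact hM' ⟨k, rfl⟩
  · have hlim : Tendsto (fun k : ℕ => eLpNorm (fun _ : E => c * (1 / ((k : ℝ) + 1))) 2 μ +
        ENNReal.ofReal (c * L) * eLpNorm (φ k - h) 2 μ) atTop (𝓝 0) := by
      have a1 : Tendsto (fun k : ℕ => eLpNorm (fun _ : E => c * (1 / ((k : ℝ) + 1))) 2 μ)
          atTop (𝓝 0) := by
        have a2 : ∀ k : ℕ, eLpNorm (fun _ : E => c * (1 / ((k : ℝ) + 1))) 2 μ =
            ‖c * (1 / ((k : ℝ) + 1))‖ₑ * μ Set.univ ^ (1 / (2 : ENNReal).toReal) := fun k =>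
          eLpNorm_const' _ (by norm_num) (by norm_num)
        simp only [a2]
        have a3 : Tendsto (fun k : ℕ => ‖c * (1 / ((k : ℝ) + 1))‖ₑ) atTop (𝓝 ‖(c * 0 : ℝ)‖ₑ) :=
          (tendsto_one_div_add_atTop_nhds_zero_nat.const_mul c).enorm
        rw [mul_zero, enorm_zero] at a3
        simpa using ENNReal.Tendsto.mul_const a3
          (Or.inr (ENNReal.rpow_ne_top_of_nonneg (by simp) (measure_ne_top μ _)))
      have a4 := ENNReal.Tendsto.const_mul (a := ENNReal.ofReal (c * L)) hφ.2.1
        (Or.inr ENNReal.ofReal_ne_top)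
      rw [mul_zero] at a4
      simpa using a1.add a4
    refine tendsto_of_tendsto_of_tendsto_of_le_of_le tendsto_const_nhds hlim (fun _ => zero_le)
      fun k => ?_
    -- Almost everywhere `T (h x) = h x`, so the error splits into the polynomial error and `L * |φ
    -- k - h|`, both multiplied by `c`.
    have hφh := (hq.isReprForm.memLp _ (hφ.1 k)).sub h2
    have b1 : ∀ᵐ x ∂μ, ‖(f * w k - f * h) x‖ ≤
        ‖((fun _ : E => c * (1 / ((k : ℝ) + 1))) + fun x : E => (c * L) * |(φ k - h) x| : E → ℝ) x‖ := by
      filter_upwards [hM] with x hx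
      have d1 : T (h x) = h x := by simp only [T]; rw [hbid _ hx, mul_one]
      have d2 := (hP k x).1
      have d3 := hTl (h x) (φ k x)
      rw [d1] at d3
      have d4 := abs_sub_le (w k x) (T (φ k x)) (h x)
      have := hc0 x
      simp only [Pi.sub_apply, Pi.mul_apply, Pi.add_apply, Real.norm_eq_abs]
      rw [abs_of_nonneg (a := c * _ + _) (by positivity), ← mul_sub, abs_mul, mul_assoc, ← mul_add]
      exact mul_le_mul (hc x) (d4.trans (add_le_add d2 d3)) (abs_nonneg _) this
    refine (eLpNorm_mono_ae b1).trans ((eLpNorm_add_le aestronglyMeasurable_const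
      (hφh.aestronglyMeasurable.norm.const_mul (c * L)) (by norm_num)).trans ?_)
    refine add_le_add le_rfl ?_
    have b2 : (fun x => (c * L) * ‖(φ k - h) x‖) = (c * (L : ℝ)) • fun x => ‖(φ k - h) x‖ := rfl
    rw [b2, eLpNorm_const_smul, eLpNorm_norm]
    -- The bound `c` is known to be nonnegative only once `E` has a point.
    rcases isEmpty_or_nonempty E with hE | ⟨⟨x⟩⟩
    · simp [Subsingleton.elim (φ k - h) 0]
    · rw [Real.enorm_of_nonneg (mul_nonneg (hc0 x) L.coe_nonneg)]

theorem integrable_squareField [IsFiniteMeasure μ] (hq : IsBiasForm ν μ C B q) {f g : E → ℝ} (hf : f ∈ C)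
    (hg : g ∈ C) : Integrable (fun x => B (f * g) x - f x * B g x - g x * B f x) μ := by
  have i := hq.isReprForm
  exact (((hq.memLp_gen _ (mul_mem hf hg)).integrable (by norm_num)).sub
    ((i.memLp _ hf).integrable_mul (hq.memLp_gen _ hg))).sub
    ((i.memLp _ hg).integrable_mul (hq.memLp_gen _ hf))

theorem integral_mul_squareField (hq : IsBiasForm ν μ C B q) {f g h : E → ℝ} (hf : f ∈ C)
    (hg : g ∈ C) (h2 : MemLp h 2 μ) (hfh : MemLp (f * h) 2 μ) (hgh : MemLp (g * h) 2 μ) :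
    ∫ x, h x * (B (f * g) x - f x * B g x - g x * B f x) ∂μ =
      (∫ x, B (f * g) x * h x ∂μ) - (∫ x, B g x * (f * h) x ∂μ) - ∫ x, B f x * (g * h) x ∂μ := by
  have i1 := (hq.memLp_gen _ (mul_mem hf hg)).integrable_mul h2
  have i2 := (hq.memLp_gen _ hg).integrable_mul hfh
  have i3 := (hq.memLp_gen _ hf).integrable_mul hgh
  have e := integral_sub (i1.sub i2) i3
  have e' := integral_sub i1 i2
  simp only [Pi.sub_apply, Pi.mul_apply] at e e'
  simp only [Pi.mul_apply]
  rw [← e', ← e]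
  congr with x
  ring

/-- The carré du champ identity on the domain of the closed form. -/
theorem isSquareField [∀ n, IsFiniteMeasure (ν n)] [IsFiniteMeasure μ] (hq : IsBiasForm ν μ C B q) :
    IsSquareField μ C (closureDomain μ C q) (closureForm μ C q)
      fun f g x => B (f * g) x - f x * B g x - g x * B f x := by
  have i := hq.isReprForm
  intro f hf g hg
  refine ⟨i.mem_closureDomain hf, i.mem_closureDomain (mul_mem hf hg),
    hq.integrable_squareField hf hg, fun h hh hb => ?_⟩
  have hfh := hq.mul_mem_closureDomain hf hh hb
  have hgh := hq.mul_mem_closureDomain hg hh hb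
  refine ⟨hfh, ?_⟩
  rw [i.closureForm_eq hg hfh, i.closureForm_eq hf hgh, i.closureForm_eq (mul_mem hf hg) hh,
    hq.integral_mul_squareField hf hg hh.1 hfh.1 hgh.1]
  ring

end IsBiasForm
end ErrorCalculus

/-! ### Locality: large increments are asymptotically negligible -/

namespace ErrorCalculus

variable {E : Type*} [MeasurableSpace E] {ν : ℕ → Measure (E × E)} {μ : Measure E}
  {C : Subalgebra ℝ (E → ℝ)} {B : (E → ℝ) → E → ℝ} {q : (E → ℝ) → (E → ℝ) → ℝ}

namespace IsBiasForm

/-- Polynomial approximation of a `C¹` function of a test function. -/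
theorem exists_isApproxSeq_comp [∀ n, IsFiniteMeasure (ν n)] [IsFiniteMeasure μ]
    (hq : IsBiasForm ν μ C B q) {f : E → ℝ} (hf : f ∈ C)
    {F : ℝ → ℝ} (hF : ContDiff ℝ ∞ F) :
    ∃ φ : ℕ → E → ℝ, IsApproxSeq μ C q φ (fun x => F (f x)) ∧
      ∀ k z, |incr (φ k) z - incr (fun x => F (f x)) z| ≤ 1 / ((k : ℝ) + 1) * |incr f z| := by
  obtain ⟨c, hc⟩ := (hq.bddMeas f hf).2
  have hP : ∀ k : ℕ, ∃ P : Polynomial ℝ, ∀ x, |P.eval (f x) - F (f x)| ≤ 1 / (k + 1) ∧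
      ∀ y, |P.eval (f y) - P.eval (f x) - (F (f y) - F (f x))| ≤ 1 / (k + 1) * |f y - f x| :=
    fun k => by
      obtain ⟨P, hP⟩ := exists_polynomial_near_of_hasDerivAt
        (fun x => (hF.differentiable (by simp) x).hasDerivAt)
        (hF.continuous_deriv (by simp)) c (Nat.one_div_pos_of_nat (n := k))
      exact ⟨P, fun x => ⟨(hP _ (hc x)).1, fun y => (hP _ (hc x)).2 _ (hc y)⟩⟩
  choose P hP using hP
  have hmem : ∀ k, (fun x => (P k).eval (f x)) ∈ C := fun k => eval_mem_subalgebra hf (P k)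
  have hinc : ∀ k z, |incr (fun x => (P k).eval (f x)) z - incr (fun x => F (f x)) z| ≤
      1 / ((k : ℝ) + 1) * |incr f z| := fun k z => (hP k z.1).2 z.2
  have h0 := tendsto_one_div_add_atTop_nhds_zero_nat (𝕜 := ℝ)
  refine ⟨fun k x => (P k).eval (f x), ⟨hmem, ?_, ?_⟩, hinc⟩
  · have a2 : ∀ k : ℕ, eLpNorm (fun _ : E => 1 / ((k : ℝ) + 1)) 2 μ =
        ‖1 / ((k : ℝ) + 1)‖ₑ * μ Set.univ ^ (1 / (2 : ENNReal).toReal) := fun k =>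
      eLpNorm_const' _ (by norm_num) (by norm_num)
    have a3 := h0.enorm
    rw [enorm_zero] at a3
    have a4 : Tendsto (fun k : ℕ => eLpNorm (fun _ : E => 1 / ((k : ℝ) + 1)) 2 μ)
        atTop (𝓝 0) := by
      simp only [a2]
      simpa using ENNReal.Tendsto.mul_const a3
        (Or.inr (ENNReal.rpow_ne_top_of_nonneg (by simp) (measure_ne_top μ _)))
    refine tendsto_of_tendsto_of_tendsto_of_le_of_le tendsto_const_nhds a4 (fun _ => zero_le)
      fun k => eLpNorm_mono fun x => ?_
    rw [Real.norm_of_nonneg (by positivity : (0 : ℝ) ≤ 1 / ((k : ℝ) + 1))]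
    exact (hP k x).1
  · have f1 : Tendsto (Prod.fst : ℕ × ℕ → ℕ) atTop atTop :=
      prod_atTop_atTop_eq (α := ℕ) (β := ℕ) ▸ tendsto_fst
    have f2 : Tendsto (Prod.snd : ℕ × ℕ → ℕ) atTop atTop :=
      prod_atTop_atTop_eq (α := ℕ) (β := ℕ) ▸ tendsto_snd
    have hlim := (((h0.comp f1).add (h0.comp f2)).pow 2).mul_const (q f f)
    rw [add_zero, zero_pow two_ne_zero, zero_mul] at hlim
    refine tendsto_of_tendsto_of_tendsto_of_le_of_le tendsto_const_nhds hlim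
      (fun k => hq.isReprForm.nonneg _ (sub_mem (hmem _) (hmem _))) fun k => ?_
    refine hq.form_le_of_abs_incr_le (sub_mem (hmem _) (hmem _)) hf fun z => ?_
    have e : incr ((fun x => (P k.1).eval (f x)) - fun x => (P k.2).eval (f x)) z =
        (incr (fun x => (P k.1).eval (f x)) z - incr (fun x => F (f x)) z) -
        (incr (fun x => (P k.2).eval (f x)) z - incr (fun x => F (f x)) z) := by
      simp only [incr, Pi.sub_apply]; ring
    rw [e]
    refine (abs_sub _ _).trans ((add_le_add (hinc k.1 z) (hinc k.2 z)).trans (le_of_eq ?_))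
    simp only [Function.comp_apply]
    ring

/-- The closed form at smooth functions of a test function is a limit of increments. -/
theorem tendsto_integral_incr_comp [∀ n, IsFiniteMeasure (ν n)] [IsFiniteMeasure μ]
    (hq : IsBiasForm ν μ C B q) {f : E → ℝ} (hf : f ∈ C) {F G : ℝ → ℝ} (hF : ContDiff ℝ ∞ F)
    (hG : ContDiff ℝ ∞ G) {L : ℝ} (hFL : ∀ x y, |F y - F x| ≤ L * |y - x|)
    (hGL : ∀ x y, |G y - G x| ≤ L * |y - x|) :
    Tendsto (fun n => ∫ z, incr (fun x => F (f x)) z * incr (fun x => G (f x)) z ∂(ν n)) atTop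
      (𝓝 (2 * closureForm μ C q (fun x => F (f x)) (fun x => G (f x)))) := by
  obtain ⟨φ, hφ, hφi⟩ := hq.exists_isApproxSeq_comp hf hF
  obtain ⟨ψ, hψ, hψi⟩ := hq.exists_isApproxSeq_comp hf hG
  have hfb := hq.bddMeas f hf
  have bF := hfb.continuous_comp_one hF.continuous
  have bG := hfb.continuous_comp_one hG.continuous
  have hlim := (hq.isReprForm.tendsto_closureForm (bF.memLp μ 2) (bG.memLp μ 2) hφ hψ).const_mul 2
  obtain ⟨M, hM0, hM⟩ := hq.exists_energy_bound hf
  have hL0 : 0 ≤ L := by simpa using (abs_nonneg _).trans (hFL 0 1)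
  refine tendsto_of_uniform_approx fun ε hε => ?_
  -- Replacing `F ∘ f` and `G ∘ f` by their `k`-th approximants costs at most `(2 * L + 1) * M / (k
  -- + 1)`, uniformly in `n`; this permits the interchange of limits. Here `2 * L + 1` is `L + (L +
  -- 1)`, the Lipschitz constants of `G` and of the approximant of `F`.
  have h0 := (tendsto_one_div_add_atTop_nhds_zero_nat (𝕜 := ℝ)).mul_const ((2 * L + 1) * M)
  rw [zero_mul] at h0
  obtain ⟨k, hk1, hk2⟩ := ((h0.eventually_le_const hε).and
    (Metric.tendsto_nhds.1 hlim ε hε)).exists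
  refine ⟨_, _, fun n => ?_, hq.lim _ (hφ.1 k) _ (hψ.1 k), hk2.le⟩
  have b1 := bF.incr.mul bG.incr
  have b2 := (hq.bddMeas _ (hφ.1 k)).incr.mul (hq.bddMeas _ (hψ.1 k)).incr
  rw [← integral_sub (b1.integrable _) (b2.integrable _)]
  refine abs_integral_le_integral_abs.trans ?_
  have hpt : ∀ z, |incr (fun x => F (f x)) z * incr (fun x => G (f x)) z -
      incr (φ k) z * incr (ψ k) z| ≤ (1 / ((k : ℝ) + 1) * (2 * L + 1)) * incr f z ^ 2 := fun z => by
    set η : ℝ := 1 / ((k : ℝ) + 1)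
    have hη0 : 0 ≤ η := by positivity
    have hη1 : η ≤ 1 := by
      simp only [η]
      rw [div_le_one (by positivity)]; linarith [Nat.cast_nonneg (α := ℝ) k]
    have a1 := hφi k z
    have a2 := hψi k z
    have a3 : |incr (fun x => G (f x)) z| ≤ L * |incr f z| := hGL _ _
    have a4 : |incr (fun x => F (f x)) z| ≤ L * |incr f z| := hFL _ _
    have a5 : |incr (φ k) z| ≤ (L + 1) * |incr f z| := by
      have := abs_add_le (incr (φ k) z - incr (fun x => F (f x)) z) (incr (fun x => F (f x)) z)
      rw [sub_add_cancel] at this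
      nlinarith [abs_nonneg (incr f z)]
    have e : incr (fun x => F (f x)) z * incr (fun x => G (f x)) z - incr (φ k) z * incr (ψ k) z =
        -((incr (φ k) z - incr (fun x => F (f x)) z) * incr (fun x => G (f x)) z +
        incr (φ k) z * (incr (ψ k) z - incr (fun x => G (f x)) z)) := by ring
    rw [e, abs_neg]
    refine (abs_add_le _ _).trans ?_
    rw [abs_mul, abs_mul]
    calc _ ≤ (η * |incr f z|) * (L * |incr f z|) + ((L + 1) * |incr f z|) * (η * |incr f z|) := by
          gcongr
      _ = η * (2 * L + 1) * |incr f z| ^ 2 := by ring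
      _ = _ := by rw [sq_abs]
  refine (integral_mono ((b1.sub b2).abs.integrable _)
    ((hfb.incr.sq.integrable _).const_mul _) hpt).trans ?_
  rw [integral_const_mul]
  calc _ ≤ 1 / ((k : ℝ) + 1) * (2 * L + 1) * M := by gcongr; exact hM n
    _ ≤ ε := by rw [mul_assoc]; exact hk1

/-- Locality: no interaction between smooth functions with disjoint supports. -/
theorem tendsto_integral_incr_of_isLocal [∀ n, IsFiniteMeasure (ν n)] [IsFiniteMeasure μ]
    (hq : IsBiasForm ν μ C B q) (hloc : IsLocal (closureDomain μ C q) (closureForm μ C q))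
    {f : E → ℝ} (hf : f ∈ C) {F G : ℝ → ℝ} (hF : ContDiff ℝ ∞ F)
    (hG : ContDiff ℝ ∞ G) (hFc : HasCompactSupport F) (hGc : HasCompactSupport G)
    (hd : Disjoint (tsupport F) (tsupport G)) :
    Tendsto (fun n => ∫ z, incr (fun x => F (f x)) z * incr (fun x => G (f x)) z ∂(ν n)) atTop
      (𝓝 0) := by
  obtain ⟨L, hL⟩ := ContDiff.lipschitzWith_of_hasCompactSupport hFc hF (by simp)
  obtain ⟨L', hL'⟩ := ContDiff.lipschitzWith_of_hasCompactSupport hGc hG (by simp)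
  -- Locality is stated for functions recentred at `0`; recentring leaves increments unchanged.
  have h := hq.tendsto_integral_incr_comp hf (F := fun t => F t - F 0) (G := fun t => G t - G 0)
    (hF.sub contDiff_const) (hG.sub contDiff_const) (L := max L L')
    (fun x y => by
      have := hL.dist_le_mul y x
      rw [Real.dist_eq, Real.dist_eq] at this
      rw [sub_sub_sub_cancel_right]
      exact this.trans (mul_le_mul_of_nonneg_right (le_max_left _ _) (abs_nonneg _)))
    (fun x y => by
      have := hL'.dist_le_mul y x
      rw [Real.dist_eq, Real.dist_eq] at this
      rw [sub_sub_sub_cancel_right]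
      exact this.trans (mul_le_mul_of_nonneg_right (le_max_right _ _) (abs_nonneg _)))
  rw [hloc f (hq.isReprForm.mem_closureDomain hf) F G hF hG hFc hGc hd, mul_zero] at h
  simpa only [incr, sub_sub_sub_cancel_right] using h

/-- Locality: large increments of a test function disappear in the limit. -/
theorem tendsto_measureReal_incr [∀ n, IsFiniteMeasure (ν n)] [IsFiniteMeasure μ]
    (hq : IsBiasForm ν μ C B q) (hloc : IsLocal (closureDomain μ C q) (closureForm μ C q))
    {f : E → ℝ} (hf : f ∈ C) {δ : ℝ} (hδ : 0 < δ) :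
    Tendsto (fun n => (ν n).real {z | δ ≤ |incr f z|}) atTop (𝓝 0) := by
  classical
  have hfb := hq.bddMeas f hf
  obtain ⟨c, hc⟩ := hfb.2
  -- If two values differ by at least `δ` and lie within `δ / 8` of centres `a` and `d`, then `a`
  -- and `d` are at least `3 * δ / 4` apart. The bumps there equal `1` at these values, and their
  -- supports, of radius `δ / 4`, are disjoint.
  obtain ⟨t, -, htf, ht⟩ := (isCompact_Icc (a := -c) (b := c)).finite_cover_balls
    (e := δ / 8) (by positivity)
  let b : ∀ a : ℝ, ContDiffBump a := fun a => ⟨δ / 8, δ / 4, by positivity, by linarith⟩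
  set s := (htf.toFinset ×ˢ htf.toFinset).filter fun p : ℝ × ℝ => 3 * δ / 4 ≤ |p.2 - p.1|
  have hdisj : ∀ p ∈ s, Disjoint (tsupport (b p.1)) (tsupport (b p.2)) := fun p hp => by
    rw [(b p.1).tsupport_eq, (b p.2).tsupport_eq]
    apply Metric.closedBall_disjoint_closedBall
    have := (Finset.mem_filter.1 hp).2
    rw [Real.dist_eq, abs_sub_comm]
    simp only [b]
    linarith
  -- Disjoint supports cancel the diagonal terms, so minus the product of increments is a sum of
  -- nonnegative cross terms. Summed over the finitely many separated pairs, it dominates the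
  -- indicator of a large increment.
  set Φ : ℝ × ℝ → E × E → ℝ := fun p z =>
    -(incr (fun x => b p.1 (f x)) z * incr (fun x => b p.2 (f x)) z)
  have hΦb : ∀ p, IsBddMeas (Φ p) := fun p => by
    have h1 : IsBddMeas (fun x => b p.1 (f x)) := hfb.continuous_comp_one (b p.1).continuous
    have h2 : IsBddMeas (fun x => b p.2 (f x)) := hfb.continuous_comp_one (b p.2).continuous
    simpa [Φ] using (IsBddMeas.const (0 : ℝ)).sub (h1.incr.mul h2.incr)
  have hΦ : ∀ p ∈ s, ∀ z, Φ p z =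
      b p.1 (f z.1) * b p.2 (f z.2) + b p.1 (f z.2) * b p.2 (f z.1) := fun p hp z => by
    have h0 : ∀ x, b p.1 x * b p.2 x = 0 := fun x => by
      by_contra hne
      exact Set.disjoint_left.1 (hdisj p hp)
        (subset_tsupport _ (left_ne_zero_of_mul hne)) (subset_tsupport _ (right_ne_zero_of_mul hne))
    simp only [Φ, incr]
    linear_combination -h0 (f z.1) - h0 (f z.2)
  have hΦ0 : ∀ p ∈ s, ∀ z, 0 ≤ Φ p z := fun p hp z => by
    rw [hΦ p hp]
    exact add_nonneg (mul_nonneg (b _).nonneg (b _).nonneg) (mul_nonneg (b _).nonneg (b _).nonneg)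
  have hlim : Tendsto (fun n => ∑ p ∈ s, ∫ z, Φ p z ∂(ν n)) atTop (𝓝 0) := by
    rw [← Finset.sum_const_zero (s := s)]
    refine tendsto_finsetSum _ fun p hp => ?_
    simp only [Φ, integral_neg]
    simpa using (hq.tendsto_integral_incr_of_isLocal hloc hf (b p.1).contDiff (b p.2).contDiff
      (b p.1).hasCompactSupport (b p.2).hasCompactSupport (hdisj p hp)).neg
  have hmeas : MeasurableSet {z | δ ≤ |incr f z|} :=
    measurableSet_le measurable_const hfb.incr.abs.1
  refine squeeze_zero (fun n => measureReal_nonneg) (fun n => ?_) hlim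
  rw [← integral_indicator_one hmeas, ← integral_finsetSum _ fun p _ => (hΦb p).integrable _]
  refine integral_mono ((integrable_const (1 : ℝ)).indicator hmeas)
    (integrable_finsetSum _ fun p _ => (hΦb p).integrable _) fun z => ?_
  by_cases hz : z ∈ {z | δ ≤ |incr f z|}
  swap
  · rw [Set.indicator_of_notMem hz]
    exact Finset.sum_nonneg fun p hp => hΦ0 p hp z
  rw [Set.indicator_of_mem hz]
  replace hz : δ ≤ |f z.2 - f z.1| := hz
  obtain ⟨a, ha, haz⟩ := Set.mem_iUnion₂.1 (ht (abs_le.1 (hc z.1)))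
  obtain ⟨d, hd, hdz⟩ := Set.mem_iUnion₂.1 (ht (abs_le.1 (hc z.2)))
  rw [Metric.mem_ball] at haz hdz
  have hp : (a, d) ∈ s := by
    refine Finset.mem_filter.2 ⟨Finset.mem_product.2 ⟨?_, ?_⟩, ?_⟩
    · simpa using ha
    · simpa using hd
    · rw [Real.dist_eq, abs_lt] at haz hdz
      rcases le_abs.1 hz with h | h
      · exact le_abs.2 (Or.inl (by linarith [haz.1, haz.2, hdz.1, hdz.2]))
      · exact le_abs.2 (Or.inr (by linarith [haz.1, haz.2, hdz.1, hdz.2]))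
  have h1 : b a (f z.1) = 1 := (b a).one_of_mem_closedBall (Metric.mem_closedBall.2 haz.le)
  have h2 : b d (f z.2) = 1 := (b d).one_of_mem_closedBall (Metric.mem_closedBall.2 hdz.le)
  calc (1 : ℝ) ≤ Φ (a, d) z := by
        rw [hΦ _ hp, h1, h2, mul_one]
        exact le_add_of_nonneg_right (mul_nonneg (b _).nonneg (b _).nonneg)
    _ ≤ ∑ p ∈ s, Φ p z := Finset.single_le_sum (f := fun p => Φ p z) (fun p hp => hΦ0 p hp z) hp

/-- A bounded function which is a small `o` of the squared increments of test functions has a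
vanishing integral in the limit. -/
theorem tendsto_integral_of_abs_le_incr_sq {ι : Type*} [Fintype ι] [∀ n, IsFiniteMeasure (ν n)]
    [IsFiniteMeasure μ]
    (hq : IsBiasForm ν μ C B q) (hloc : IsLocal (closureDomain μ C q) (closureForm μ C q))
    {f : ι → E → ℝ} (hf : ∀ i, f i ∈ C) {Φ : E × E → ℝ} (hΦ : IsBddMeas Φ)
    (h : ∀ ε > 0, ∃ δ > 0, ∀ z, (∀ i, |incr (f i) z| < δ) → |Φ z| ≤ ε * ∑ i, incr (f i) z ^ 2) :
    Tendsto (fun n => ∫ z, Φ z ∂(ν n)) atTop (𝓝 0) := by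
  choose M hM0 hM using fun i => hq.exists_energy_bound (hf i)
  obtain ⟨K, hK⟩ := hΦ.2
  have hMs : 0 ≤ ∑ i, M i := Finset.sum_nonneg fun i _ => hM0 i
  refine tendsto_of_uniform_approx fun ε hε => ?_
  -- Where all increments are below `δ`, the energy bounds make the integral at most `ε`. On the
  -- rest, `Φ` is bounded and the measure tends to zero. The `+ 1` keeps the denominator positive.
  obtain ⟨δ, hδ, h⟩ := h (ε / (∑ i, M i + 1)) (by positivity)
  set S : ι → Set (E × E) := fun i => {z | δ ≤ |incr (f i) z|}
  have hS : ∀ i, MeasurableSet (S i) := fun i =>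
    measurableSet_le measurable_const (hq.bddMeas _ (hf i)).incr.abs.1
  set b : ℕ → ℝ := fun n => ∫ z, (⋃ i, S i).indicator Φ z ∂(ν n)
  have hU : MeasurableSet (⋃ i, S i) := MeasurableSet.iUnion hS
  refine ⟨b, 0, fun n => ?_, ?_, by simpa using hε.le⟩
  · rw [← integral_sub (hΦ.integrable _) ((hΦ.integrable _).indicator hU)]
    have i1 : Integrable (fun z => ε / (∑ i, M i + 1) * ∑ i, incr (f i) z ^ 2) (ν n) :=
      (integrable_finsetSum _ fun i _ => (hq.bddMeas _ (hf i)).incr.sq.integrable _).const_mul _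
    refine abs_integral_le_integral_abs.trans ((integral_mono
      ((hΦ.integrable _).sub ((hΦ.integrable _).indicator hU)).abs i1 fun z => ?_).trans ?_)
    · by_cases hz : z ∈ ⋃ i, S i
      · simp only [Set.indicator_of_mem hz, sub_self, abs_zero, Pi.sub_apply]
        positivity
      · simp only [Set.indicator_of_notMem hz, sub_zero, Pi.sub_apply]
        refine h z fun i => ?_
        by_contra hi
        exact hz (Set.mem_iUnion.2 ⟨i, not_lt.1 hi⟩)
    · rw [integral_const_mul, integral_finsetSum _ fun i _ =>
        (hq.bddMeas _ (hf i)).incr.sq.integrable _]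
      calc _ ≤ ε / (∑ i, M i + 1) * (∑ i, M i + 1) := by
            gcongr
            exact (Finset.sum_le_sum fun i _ => hM i n).trans (by linarith)
        _ = ε := by field_simp
  · have hlim : Tendsto (fun n => K * ∑ i, (ν n).real (S i)) atTop (𝓝 0) := by
      have := (tendsto_finsetSum (Finset.univ : Finset ι) fun i _ =>
        hq.tendsto_measureReal_incr hloc (hf i) hδ).const_mul K
      simpa using this
    refine squeeze_zero_norm (fun n => ?_) hlim
    simp only [b]
    rw [integral_indicator hU]
    refine (norm_setIntegral_le_of_norm_le_const (measure_lt_top _ _) fun z _ => hK z).trans ?_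
    rcases isEmpty_or_nonempty (E × E) with hE | ⟨⟨z⟩⟩
    · simp [Measure.eq_zero_of_isEmpty]
    · exact mul_le_mul_of_nonneg_left (measureReal_iUnion_fintype_le _)
        ((abs_nonneg _).trans (hK z))

end IsBiasForm
end ErrorCalculus

/-! ### Weighted limits of increments and the error calculus -/

namespace ErrorCalculus

/-- Continuous functions operate on the uniform closure of an algebra of bounded functions. -/
theorem exists_mem_subalgebra_near_comp {X ι : Type*} [Fintype ι] {C : Subalgebra ℝ (X → ℝ)}
    {f : ι → X → ℝ} (hf : ∀ i, f i ∈ C) {c : ℝ} (hc : ∀ i x, |f i x| ≤ c) (hc0 : 0 ≤ c)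
    {G : (ι → ℝ) → ℝ} (hG : Continuous G) {ε : ℝ} (hε : 0 < ε) :
    ∃ χ ∈ C, ∀ x, |χ x - G fun i => f i x| ≤ ε := by
  have hmem : ∀ x, (fun i => f i x) ∈ Metric.closedBall (0 : ι → ℝ) c := fun x => by
    rw [mem_closedBall_zero_iff, pi_norm_le_iff_of_nonneg hc0]
    exact fun i => hc i x
  let K := Metric.closedBall (0 : ι → ℝ) c
  have : CompactSpace K := isCompact_iff_compactSpace.1 (isCompact_closedBall _ _)
  -- Stone–Weierstrass applies on the compact ball containing all values of `f`: the pullback of `C`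
  -- along composition with `f` contains the coordinates, hence separates points.
  let ev : C(K, ℝ) →ₐ[ℝ] (X → ℝ) :=
    { toFun := fun u x => u ⟨_, hmem x⟩
      map_one' := rfl
      map_mul' := fun _ _ => rfl
      map_zero' := rfl
      map_add' := fun _ _ => rfl
      commutes' := fun _ => rfl }
  have hsep : (C.comap ev).SeparatesPoints := fun a b hab => by
    obtain ⟨i, hi⟩ : ∃ i, a.1 i ≠ b.1 i := by
      by_contra! h
      exact hab (Subtype.ext (funext h))
    let p : C(K, ℝ) := ⟨fun a => a.1 i, (continuous_apply i).comp continuous_subtype_val⟩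
    exact ⟨p, ⟨p, hf i, rfl⟩, hi⟩
  let G' : C(K, ℝ) := ⟨fun a => G a.1, hG.comp continuous_subtype_val⟩
  obtain ⟨u, hu⟩ := ContinuousMap.exists_mem_subalgebra_near_continuousMap_of_separatesPoints
    (C.comap ev) hsep G' ε hε
  exact ⟨ev u, u.2, fun x => ((u.1 - G').norm_coe_le_norm ⟨_, hmem x⟩).trans hu.le⟩

/-- First order expansion with a remainder which is uniformly small on a compact ball. -/
theorem exists_delta_taylor {V : Type*} [NormedAddCommGroup V] [NormedSpace ℝ V]
    [FiniteDimensional ℝ V] {F : V → ℝ} (hF : ContDiff ℝ 1 F) (c : ℝ) {ε : ℝ} (hε : 0 < ε) :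
    ∃ δ > 0, ∀ a ∈ Metric.closedBall (0 : V) c, ∀ b ∈ Metric.closedBall (0 : V) c, dist b a < δ →
      |F b - F a - fderiv ℝ F a (b - a)| ≤ ε * ‖b - a‖ := by
  have : ProperSpace V := FiniteDimensional.proper ℝ V
  have huc := (isCompact_closedBall (0 : V) c).uniformContinuousOn_of_continuous
    (hF.continuous_fderiv (by simp)).continuousOn
  obtain ⟨δ, hδ, h⟩ := Metric.uniformContinuousOn_iff.1 huc ε hε
  refine ⟨δ, hδ, fun a ha b hb hab => ?_⟩
  -- The mean value inequality is applied on a convex set where the derivative stays within `ε` of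
  -- its value at `a`.
  have hconv : Convex ℝ (Metric.closedBall (0 : V) c ∩ Metric.ball a δ) :=
    (convex_closedBall _ _).inter (convex_ball _ _)
  refine hconv.norm_image_sub_le_of_norm_hasFDerivWithin_le'
    (f' := fderiv ℝ F) (fun x _ => ((hF.differentiable (by simp)) x).hasFDerivAt.hasFDerivWithinAt)
    (fun x hx => ?_) ⟨ha, Metric.mem_ball_self hδ⟩ ⟨hb, hab⟩
  rw [← dist_eq_norm]
  exact (h x hx.1 a ha hx.2).le

variable {E : Type*} [MeasurableSpace E] {ν : ℕ → Measure (E × E)} {μ : Measure E}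
  {C : Subalgebra ℝ (E → ℝ)} {B : (E → ℝ) → E → ℝ} {q : (E → ℝ) → (E → ℝ) → ℝ}

namespace IsBiasForm

/-- Writing `Δ` for increments and `χ` for its value at the first point, `2 χ Δf Δg = Δ(fχ) Δg +
Δ(gχ) Δf - Δ(fg) Δχ - Δf Δg Δχ`. The first three terms converge by the definition of the form and
assemble into `Γ`; locality kills the last. -/
theorem tendsto_integral_incr_mul_mem [∀ n, IsFiniteMeasure (ν n)] [IsFiniteMeasure μ]
    (hq : IsBiasForm ν μ C B q) (hloc : IsLocal (closureDomain μ C q) (closureForm μ C q))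
    {f g χ : E → ℝ} (hf : f ∈ C) (hg : g ∈ C) (hχ : χ ∈ C) :
    Tendsto (fun n => ∫ z, incr f z * incr g z * χ z.1 ∂(ν n)) atTop
      (𝓝 (∫ x, χ x * (B (f * g) x - f x * B g x - g x * B f x) ∂μ)) := by
  have bf := (hq.bddMeas f hf).incr
  have bg := (hq.bddMeas g hg).incr
  have bχ := (hq.bddMeas χ hχ).incr
  have b3 : IsBddMeas fun z => incr f z * incr g z * incr χ z := (bf.mul bg).mul bχ
  have h3 : Tendsto (fun n => ∫ z, incr f z * incr g z * incr χ z ∂(ν n)) atTop (𝓝 0) := by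
    refine hq.tendsto_integral_of_abs_le_incr_sq hloc (f := ![f, g, χ])
      (fun i => by fin_cases i; exacts [hf, hg, hχ]) b3 fun ε hε => ⟨ε, hε, fun z hz => ?_⟩
    have h2 : |incr χ z| < ε := hz 2
    simp only [Fin.sum_univ_three, Matrix.cons_val]
    rw [abs_mul, mul_comm]
    refine mul_le_mul h2.le ?_ (abs_nonneg _) hε.le
    refine abs_le.2 ⟨?_, ?_⟩ <;>
      nlinarith [sq_nonneg (incr f z + incr g z), sq_nonneg (incr f z - incr g z),
        sq_nonneg (incr f z), sq_nonneg (incr g z), sq_nonneg (incr χ z)]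
  have hfχ := mul_mem hf hχ
  have hgχ := mul_mem hg hχ
  have hfg := mul_mem hf hg
  have hlim := ((((hq.lim _ hfχ _ hg).add (hq.lim _ hgχ _ hf)).sub (hq.lim _ hfg _ hχ)).sub
    h3).const_mul (1 / 2)
  have i := hq.isReprForm
  rw [i.symm _ hfχ _ hg, i.symm _ hgχ _ hf, hq.repr _ hg _ hfχ, hq.repr _ hf _ hgχ,
    hq.repr _ hfg _ hχ] at hlim
  rw [hq.integral_mul_squareField hf hg (i.memLp _ hχ) (i.memLp _ hfχ) (i.memLp _ hgχ)]
  have b : ∀ u ∈ C, ∀ v ∈ C, IsBddMeas fun z => incr u z * incr v z :=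
    fun u hu v hv => (hq.bddMeas u hu).incr.mul (hq.bddMeas v hv).incr
  have b1 := b _ hfχ _ hg
  have b2 := b _ hgχ _ hf
  have b4 := b _ hfg _ hχ
  convert hlim using 2 with n
  · rw [← integral_add (b1.integrable _) (b2.integrable _),
      ← integral_sub ((b1.add b2).integrable _) (b4.integrable _),
      ← integral_sub (((b1.add b2).sub b4).integrable _) (b3.integrable _), ← integral_const_mul]
    congr with z
    simp only [incr, Pi.mul_apply]
    ring
  · ring

/-- The weight is a uniform limit of elements of `C`. The error is controlled on one side by the
energies of `f` and `g`, on the other by the `L¹` norm of `Γ`; `R` majorises both. -/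
theorem tendsto_integral_incr_mul_comp {ι : Type*} [Fintype ι] [∀ n, IsFiniteMeasure (ν n)]
    [IsFiniteMeasure μ]
    (hq : IsBiasForm ν μ C B q) (hloc : IsLocal (closureDomain μ C q) (closureForm μ C q))
    {f g : E → ℝ} (hf : f ∈ C) (hg : g ∈ C) {φ : ι → E → ℝ} (hφ : ∀ i, φ i ∈ C)
    {G : (ι → ℝ) → ℝ} (hG : Continuous G) :
    Tendsto (fun n => ∫ z, incr f z * incr g z * G (fun i => φ i z.1) ∂(ν n)) atTop
      (𝓝 (∫ x, G (fun i => φ i x) * (B (f * g) x - f x * B g x - g x * B f x) ∂μ)) := by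
  have bf := (hq.bddMeas f hf).incr
  have bg := (hq.bddMeas g hg).incr
  have bG := IsBddMeas.continuous_comp (fun i => hq.bddMeas _ (hφ i)) hG
  obtain ⟨c, hc0, hc⟩ := IsBddMeas.exists_common_bound fun i => hq.bddMeas _ (hφ i)
  obtain ⟨M, hM0, hM⟩ := hq.exists_energy_bound hf
  obtain ⟨M', hM0', hM'⟩ := hq.exists_energy_bound hg
  have iΓ := hq.integrable_squareField hf hg
  set Γ : E → ℝ := fun x => B (f * g) x - f x * B g x - g x * B f x
  set R : ℝ := M + M' + ∫ x, |Γ x| ∂μ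
  have hΓ0 : 0 ≤ ∫ x, |Γ x| ∂μ := integral_nonneg fun x => abs_nonneg _
  refine tendsto_of_uniform_approx fun ε hε => ?_
  obtain ⟨χ, hχ, hχG⟩ := exists_mem_subalgebra_near_comp hφ hc hc0 hG
    (ε := ε / (R + 1)) (by positivity)
  have bχ := hq.bddMeas χ hχ
  have hle : ε / (R + 1) * R ≤ ε := by
    rw [div_mul_eq_mul_div, div_le_iff₀ (by positivity)]
    nlinarith
  refine ⟨_, _, fun n => ?_, hq.tendsto_integral_incr_mul_mem hloc hf hg hχ, ?_⟩
  · have b1 := (bf.mul bg).mul (bG.comp (measurable_fst (β := E)))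
    have b2 := (bf.mul bg).mul (bχ.comp (measurable_fst (β := E)))
    rw [← integral_sub (b1.integrable _) (b2.integrable _)]
    refine abs_integral_le_integral_abs.trans ((integral_mono ((b1.sub b2).abs.integrable _)
      (((bf.sq.add bg.sq).integrable _).const_mul (ε / (R + 1))) fun z => ?_).trans ?_)
    · have e : incr f z * incr g z * G (fun i => φ i z.1) - incr f z * incr g z * χ z.1 =
          -((χ z.1 - G (fun i => φ i z.1)) * (incr f z * incr g z)) := by ring
      simp only [e, abs_neg]
      rw [abs_mul]
      refine mul_le_mul (hχG _) ?_ (abs_nonneg _) (by positivity)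
      refine abs_le.2 ⟨?_, ?_⟩ <;>
        nlinarith [sq_nonneg (incr f z + incr g z), sq_nonneg (incr f z - incr g z),
          sq_nonneg (incr f z), sq_nonneg (incr g z)]
    · rw [integral_const_mul, integral_add (bf.sq.integrable _) (bg.sq.integrable _)]
      refine le_trans ?_ hle
      gcongr
      linarith [hM n, hM' n]
  · have j1 : Integrable (fun x => χ x * Γ x) μ := iΓ.bdd_mul bχ.1.aestronglyMeasurable
      (Eventually.of_forall fun x => bχ.2.choose_spec x)
    have j2 : Integrable (fun x => G (fun i => φ i x) * Γ x) μ :=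
      iΓ.bdd_mul bG.1.aestronglyMeasurable (Eventually.of_forall fun x => bG.2.choose_spec x)
    rw [← integral_sub j1 j2]
    refine abs_integral_le_integral_abs.trans ((integral_mono (j1.sub j2).abs
      (iΓ.abs.const_mul (ε / (R + 1))) fun x => ?_).trans ?_)
    · simp only [Pi.sub_apply]
      rw [← sub_mul, abs_mul]
      exact mul_le_mul_of_nonneg_right (hχG x) (abs_nonneg _)
    · rw [integral_const_mul]
      refine le_trans ?_ hle
      gcongr
      simp only [R]
      linarith

theorem integrable_gradient_squareField {ι : Type*} [Fintype ι] [IsFiniteMeasure μ]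
    (hq : IsBiasForm ν μ C B q)
    {f g : E → ℝ} (hf : f ∈ C) (hg : g ∈ C) {φ : ι → E → ℝ} (hφ : ∀ i, φ i ∈ C)
    {G : (ι → ℝ) → ℝ} (hG : Continuous G) :
    Integrable (fun x => G (fun i => φ i x) * (B (f * g) x - f x * B g x - g x * B f x)) μ := by
  have bG := IsBddMeas.continuous_comp (fun i => hq.bddMeas _ (hφ i)) hG
  exact (hq.integrable_squareField hf hg).bdd_mul bG.1.aestronglyMeasurable
    (Eventually.of_forall fun x => bG.2.choose_spec x)

/-- The asymptotic error calculus principle. -/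
theorem tendsto_integral_incr_sq {p : ℕ} [∀ n, IsFiniteMeasure (ν n)] [IsFiniteMeasure μ]
    (hq : IsBiasForm ν μ C B q) (hloc : IsLocal (closureDomain μ C q) (closureForm μ C q))
    {f : Fin p → E → ℝ} (hf : ∀ i, f i ∈ C) {F : (Fin p → ℝ) → ℝ} (hF : ContDiff ℝ 1 F) :
    Integrable (fun x => ∑ i, ∑ j, fderiv ℝ F (fun k => f k x) (Pi.single i 1) *
      fderiv ℝ F (fun k => f k x) (Pi.single j 1) *
      (B (f i * f j) x - f i x * B (f j) x - f j x * B (f i) x)) μ ∧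
    Tendsto (fun n => ∫ z, incr (fun x => F fun k => f k x) z ^ 2 ∂(ν n)) atTop
      (𝓝 (∫ x, ∑ i, ∑ j, fderiv ℝ F (fun k => f k x) (Pi.single i 1) *
        fderiv ℝ F (fun k => f k x) (Pi.single j 1) *
        (B (f i * f j) x - f i x * B (f j) x - f j x * B (f i) x) ∂μ)) := by
  have hF' : Continuous (fderiv ℝ F) := hF.continuous_fderiv (by simp)
  have hd : ∀ i, Continuous fun a => fderiv ℝ F a (Pi.single i 1) := fun i =>
    hF'.clm_apply continuous_const
  have hdd : ∀ i j, Continuous fun a =>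
      fderiv ℝ F a (Pi.single i 1) * fderiv ℝ F a (Pi.single j 1) := fun i j => (hd i).mul (hd j)
  have hint := fun i j => hq.integrable_gradient_squareField (hf i) (hf j) hf (hdd i j)
  refine ⟨integrable_finsetSum _ fun i _ => integrable_finsetSum _ fun j _ => hint i j, ?_⟩
  obtain ⟨c, hc0, hc⟩ := IsBddMeas.exists_common_bound fun i => hq.bddMeas _ (hf i)
  have hball : ∀ x, (fun k => f k x) ∈ Metric.closedBall (0 : Fin p → ℝ) c := fun x => by
    rw [mem_closedBall_zero_iff, pi_norm_le_iff_of_nonneg hc0]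
    exact fun i => hc i x
  have bf := fun i => (hq.bddMeas _ (hf i)).incr
  have bF : IsBddMeas fun x => F fun k => f k x :=
    IsBddMeas.continuous_comp (fun i => hq.bddMeas _ (hf i)) hF.continuous
  have bd : ∀ i, IsBddMeas fun x => fderiv ℝ F (fun k => f k x) (Pi.single i 1) := fun i =>
    IsBddMeas.continuous_comp (fun i => hq.bddMeas _ (hf i)) (hd i)
  have bterm : ∀ i j, IsBddMeas fun z : E × E => incr (f i) z * incr (f j) z *
      (fderiv ℝ F (fun k => f k z.1) (Pi.single i 1) *
        fderiv ℝ F (fun k => f k z.1) (Pi.single j 1)) := fun i j =>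
    ((bf i).mul (bf j)).mul (((bd i).mul (bd j)).comp measurable_fst)
  -- The first-order part of the increment of `F`; its square expands into weighted products of
  -- increments, whose limits are known.
  set ℓ : E × E → ℝ := fun z => ∑ i, incr (f i) z * fderiv ℝ F (fun k => f k z.1) (Pi.single i 1)
  have bℓ : IsBddMeas ℓ := IsBddMeas.sum _ fun i _ => (bf i).mul ((bd i).comp measurable_fst)
  have hℓ : ∀ z, ℓ z = fderiv ℝ F (fun k => f k z.1) ((fun k => f k z.2) - fun k => f k z.1) :=
    fun z => by
      rw [pi_eq_sum_univ' ((fun k => f k z.2) - fun k => f k z.1), map_sum]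
      exact Finset.sum_congr rfl fun i _ => by rw [map_smul]; rfl
  have hmain : Tendsto (fun n => ∫ z, ℓ z ^ 2 ∂(ν n)) atTop
      (𝓝 (∫ x, ∑ i, ∑ j, fderiv ℝ F (fun k => f k x) (Pi.single i 1) *
        fderiv ℝ F (fun k => f k x) (Pi.single j 1) *
        (B (f i * f j) x - f i x * B (f j) x - f j x * B (f i) x) ∂μ)) := by
    rw [integral_finsetSum _ fun i _ => integrable_finsetSum _ fun j _ => hint i j]
    simp_rw [integral_finsetSum (Finset.univ : Finset (Fin p)) fun j _ => hint _ j]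
    have h := tendsto_finsetSum (Finset.univ : Finset (Fin p)) fun i _ =>
      tendsto_finsetSum (Finset.univ : Finset (Fin p)) fun j _ =>
        hq.tendsto_integral_incr_mul_comp hloc (hf i) (hf j) hf (hdd i j)
    refine h.congr fun n => ?_
    simp_rw [← integral_finsetSum (Finset.univ : Finset (Fin p)) fun j _ =>
      (bterm _ j).integrable (ν n)]
    rw [← integral_finsetSum _ fun i _ =>
      integrable_finsetSum _ fun j _ => (bterm i j).integrable (ν n)]
    congr with z
    simp only [ℓ, pow_two, Finset.sum_mul_sum]
    exact Finset.sum_congr rfl fun i _ => Finset.sum_congr rfl fun j _ => by ring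
  obtain ⟨L, hL⟩ := (isCompact_closedBall (0 : Fin p → ℝ) c).exists_bound_of_continuousOn
    hF'.continuousOn
  have hL0 : 0 ≤ L := (norm_nonneg _).trans (hL 0 (Metric.mem_closedBall_self hc0))
  have bΔ : IsBddMeas fun z => incr (fun x => F fun k => f k x) z ^ 2 - ℓ z ^ 2 :=
    bF.incr.sq.sub bℓ.sq
  have hrem : Tendsto (fun n => ∫ z, (incr (fun x => F fun k => f k x) z ^ 2 - ℓ z ^ 2) ∂(ν n))
      atTop (𝓝 0) := by
    refine hq.tendsto_integral_of_abs_le_incr_sq hloc hf bΔ fun ε hε => ?_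
    -- Factor the difference of squares: one factor is the Taylor remainder, small relative to `‖b -
    -- a‖`, the other is at most `2 * L * ‖b - a‖`. The sup norm satisfies `‖b - a‖ ^ 2 ≤ ∑ i, incr
    -- (f i) z ^ 2`.
    obtain ⟨δ, hδ, hT⟩ := exists_delta_taylor hF c (ε := ε / (2 * L + 1)) (by positivity)
    refine ⟨δ, hδ, fun z hz => ?_⟩
    set a : Fin p → ℝ := fun k => f k z.1
    set b : Fin p → ℝ := fun k => f k z.2
    have hab : dist b a < δ := (dist_pi_lt_iff hδ).2 hz
    have h1 := hT a (hball _) b (hball _) hab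
    have h2 : |F b - F a| ≤ L * ‖b - a‖ :=
      (convex_closedBall (0 : Fin p → ℝ) c).norm_image_sub_le_of_norm_fderiv_le
        (fun x _ => (hF.differentiable (by simp)) x) hL (hball z.1) (hball z.2)
    have h3 : |ℓ z| ≤ L * ‖b - a‖ := by
      rw [hℓ]
      exact ((fderiv ℝ F a).le_opNorm _).trans
        (mul_le_mul_of_nonneg_right (hL _ (hball _)) (norm_nonneg _))
    rw [← hℓ] at h1
    have h4 : ‖b - a‖ ^ 2 ≤ ∑ i, incr (f i) z ^ 2 := by
      have hs : 0 ≤ ∑ i, incr (f i) z ^ 2 := Finset.sum_nonneg fun i _ => sq_nonneg _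
      rw [← Real.sqrt_le_sqrt_iff hs, Real.sqrt_sq (norm_nonneg _),
        pi_norm_le_iff_of_nonneg (Real.sqrt_nonneg _)]
      intro i
      exact Real.abs_le_sqrt (Finset.single_le_sum (f := fun i => incr (f i) z ^ 2)
        (fun i _ => sq_nonneg _) (Finset.mem_univ i))
    change |(F b - F a) ^ 2 - ℓ z ^ 2| ≤ _
    have e : (F b - F a) ^ 2 - ℓ z ^ 2 = (F b - F a - ℓ z) * (F b - F a + ℓ z) := by ring
    rw [e, abs_mul]
    calc _ ≤ (ε / (2 * L + 1) * ‖b - a‖) * (L * ‖b - a‖ + L * ‖b - a‖) := by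
          gcongr
          exact (abs_add_le _ _).trans (add_le_add h2 h3)
      _ = ε * (2 * L / (2 * L + 1)) * ‖b - a‖ ^ 2 := by ring
      _ ≤ ε * 1 * ∑ i, incr (f i) z ^ 2 := by
          gcongr
          rw [div_le_one (by positivity)]
          linarith
      _ = _ := by rw [mul_one]
  have h := hmain.add hrem
  rw [add_zero] at h
  refine h.congr fun n => ?_
  rw [integral_sub (bF.incr.sq.integrable _) (bℓ.sq.integrable _)]
  ring

end IsBiasForm
end ErrorCalculus

/-! ### Passage from the random variables to the abstract setting -/

namespace ErrorCalculus

/-- The real-valued elements of a star algebra of `𝕜`-valued functions, as a real algebra. -/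
def realSubalgebra {E 𝕜 : Type*} [RCLike 𝕜] (𝒟 : StarSubalgebra 𝕜 (E → 𝕜)) :
    Subalgebra ℝ (E → ℝ) where
  carrier := realPart 𝒟
  mul_mem' {φ χ} hφ hχ := by
    have : toK 𝕜 (φ * χ) = toK 𝕜 φ * toK 𝕜 χ := by ext x; simp [toK]
    change toK 𝕜 (φ * χ) ∈ 𝒟
    rw [this]
    exact mul_mem hφ hχ
  add_mem' {φ χ} hφ hχ := by
    have : toK 𝕜 (φ + χ) = toK 𝕜 φ + toK 𝕜 χ := by ext x; simp [toK]
    change toK 𝕜 (φ + χ) ∈ 𝒟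
    rw [this]
    exact add_mem hφ hχ
  algebraMap_mem' r := algebraMap_mem 𝒟 (r : 𝕜)

/-- The weighted joint law of `(Y, Y_n)`. -/
noncomputable def pairMeasure {Ω E : Type*} [MeasurableSpace Ω] [MeasurableSpace E] (P : Measure Ω) (Y : Ω → E)
    (Yn : ℕ → Ω → E) (α : ℕ → ℝ) (n : ℕ) : Measure (E × E) :=
  ENNReal.ofReal (α n) • P.map fun w => (Y w, Yn n w)

section

variable {Ω E 𝕜 : Type*} [MeasurableSpace Ω] [MeasurableSpace E] [RCLike 𝕜]
  {P : Measure Ω} {Y : Ω → E} {Yn : ℕ → Ω → E} {α : ℕ → ℝ}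

instance [IsProbabilityMeasure P] (n : ℕ) : IsFiniteMeasure (pairMeasure P Y Yn α n) :=
  Measure.smul_finite _ ENNReal.ofReal_ne_top

theorem integral_pairMeasure (hY : Measurable Y) (hYn : ∀ n, Measurable (Yn n))
    (hα : ∀ n, 0 < α n) {Φ : E × E → ℝ} (hΦ : Measurable Φ) (n : ℕ) :
    ∫ z, Φ z ∂(pairMeasure P Y Yn α n) = α n * ∫ w, Φ (Y w, Yn n w) ∂P := by
  rw [pairMeasure, integral_smul_measure, ENNReal.toReal_ofReal (hα n).le, smul_eq_mul,
    integral_map (hY.prodMk (hYn n)).aemeasurable hΦ.aestronglyMeasurable]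

theorem isBddMeas_of_mem_realPart {𝒟 : StarSubalgebra 𝕜 (E → 𝕜)} {μ : Measure E}
    (h𝒟 : IsTestAlgebra μ 𝒟) {φ : E → ℝ} (hφ : φ ∈ realPart 𝒟) : IsBddMeas φ := by
  obtain ⟨c, hc⟩ := h𝒟.bounded _ hφ
  refine ⟨?_, c, fun x => by simpa [toK] using hc x⟩
  have h := RCLike.measurable_re.comp (h𝒟.measurable _ hφ)
  have e : RCLike.re ∘ toK 𝕜 φ = φ := funext fun x => RCLike.ofReal_re _
  rwa [e] at h

/-- For real test functions the increments are real, so taking real parts in (H3) loses nothing and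
the real part of `A` represents the form. -/
theorem isBiasForm_preForm [IsProbabilityMeasure P] (hY : Measurable Y)
    (hYn : ∀ n, Measurable (Yn n)) (hα : ∀ n, 0 < α n)
    {𝒟 : StarSubalgebra 𝕜 (E → 𝕜)} (h𝒟 : IsTestAlgebra (P.map Y) 𝒟)
    {A : (E → 𝕜) → E → 𝕜} (hA : IsSymmetricBias P Y Yn α 𝒟 A) :
    IsBiasForm (pairMeasure P Y Yn α) (P.map Y) (realSubalgebra 𝒟)
      (fun φ x => RCLike.re (A (toK 𝕜 φ) x)) (preForm P Y Yn α) := by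
  have hb : ∀ φ ∈ realSubalgebra 𝒟, IsBddMeas φ := fun φ hφ => isBddMeas_of_mem_realPart h𝒟 hφ
  have : IsProbabilityMeasure (P.map Y) := Measure.isProbabilityMeasure_map hY.aemeasurable
  have hlim : ∀ φ ∈ realSubalgebra 𝒟, ∀ χ ∈ realSubalgebra 𝒟,
      Tendsto (fun n => ∫ z, incr φ z * incr χ z ∂(pairMeasure P Y Yn α n)) atTop
        (𝓝 (-2 * ∫ x, RCLike.re (A (toK 𝕜 φ) x) * χ x ∂(P.map Y))) := fun φ hφ χ hχ => by
    obtain ⟨hm, h⟩ := hA _ hφ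
    have h' := (RCLike.continuous_re.tendsto _).comp (h _ hχ)
    have hi : Integrable (fun x => A (toK 𝕜 φ) x * toK 𝕜 χ x) (P.map Y) := by
      have : MemLp (toK 𝕜 χ) 2 (P.map Y) := ((hb χ hχ).memLp (P.map Y) 2).ofReal
      exact hm.integrable_mul this
    have e : RCLike.re (-2 * ∫ x, A (toK 𝕜 φ) x * toK 𝕜 χ x ∂(P.map Y)) =
        -2 * ∫ x, RCLike.re (A (toK 𝕜 φ) x) * χ x ∂(P.map Y) := by
      have e1 : (-2 : 𝕜) = ((-2 : ℝ) : 𝕜) := by rw [RCLike.ofReal_neg, RCLike.ofReal_ofNat]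
      rw [e1, RCLike.re_ofReal_mul, ← integral_re hi]
      simp [toK]
    rw [e] at h'
    refine h'.congr fun n => ?_
    rw [integral_pairMeasure hY hYn hα ((hb φ hφ).incr.mul (hb χ hχ).incr).1]
    rw [Function.comp_apply, RCLike.re_ofReal_mul]
    congr 1
    have e2 : (fun w => (toK 𝕜 φ (Yn n w) - toK 𝕜 φ (Y w)) *
        (toK 𝕜 χ (Yn n w) - toK 𝕜 χ (Y w))) = fun w =>
        ((((φ (Yn n w) - φ (Y w)) * (χ (Yn n w) - χ (Y w)) : ℝ)) : 𝕜) := by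
      ext w; simp [toK]
    rw [e2, integral_ofReal, RCLike.ofReal_re]
    rfl
  have hrepr : ∀ φ ∈ realSubalgebra 𝒟, ∀ χ ∈ realSubalgebra 𝒟,
      preForm P Y Yn α φ χ = -∫ x, RCLike.re (A (toK 𝕜 φ) x) * χ x ∂(P.map Y) :=
    fun φ hφ χ hχ => by
      refine Tendsto.limUnder_eq ?_
      have h := (hlim φ hφ χ hχ).const_mul (1 / 2)
      convert h using 2 with n
      · rw [integral_pairMeasure hY hYn hα ((hb φ hφ).incr.mul (hb χ hχ).incr).1]
        simp only [incr]
        ring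
      · ring
  refine ⟨hb, fun φ hφ => (hA _ hφ).1.re, hrepr, fun φ hφ χ hχ => ?_⟩
  rw [hrepr φ hφ χ hχ]
  convert hlim φ hφ χ hχ using 2
  ring

end

end ErrorCalculus

theorem mainTheorem3 {Ω E 𝕜 : Type*} [MeasurableSpace Ω] [MeasurableSpace E] [RCLike 𝕜]
    (P : Measure Ω) [IsProbabilityMeasure P]
    (Y : Ω → E) (hY : Measurable Y) (Yn : ℕ → Ω → E) (hYn : ∀ n, Measurable (Yn n))
    (α : ℕ → ℝ) (hα : ∀ n, 0 < α n)
    (𝒟 : StarSubalgebra 𝕜 (E → 𝕜)) (h𝒟 : ErrorCalculus.IsTestAlgebra (P.map Y) 𝒟)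
    (A : (E → 𝕜) → E → 𝕜) (hA : ErrorCalculus.IsSymmetricBias P Y Yn α 𝒟 A)
    (hlocal : ErrorCalculus.IsLocal (ErrorCalculus.formDomain P Y Yn α 𝒟)
      (ErrorCalculus.form P Y Yn α 𝒟)) :
    ErrorCalculus.IsSquareField (P.map Y) (ErrorCalculus.realPart 𝒟)
      (ErrorCalculus.formDomain P Y Yn α 𝒟) (ErrorCalculus.form P Y Yn α 𝒟)
      (ErrorCalculus.squareField A) ∧
    ∀ (p : ℕ) (f : Fin p → E → ℝ), (∀ i, f i ∈ ErrorCalculus.realPart 𝒟) →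
      ∀ F : (Fin p → ℝ) → ℝ, ContDiff ℝ 1 F →
        Integrable (fun x => ∑ i, ∑ j,
            fderiv ℝ F (fun k => f k x) (Pi.single i 1) *
            fderiv ℝ F (fun k => f k x) (Pi.single j 1) *
            ErrorCalculus.squareField A (f i) (f j) x) (P.map Y) ∧
        Tendsto (fun n => α n *
            ∫ w, (F (fun k => f k (Yn n w)) - F (fun k => f k (Y w))) ^ 2 ∂P) atTop
          (𝓝 (∫ x, ∑ i, ∑ j,
            fderiv ℝ F (fun k => f k x) (Pi.single i 1) *
            fderiv ℝ F (fun k => f k x) (Pi.single j 1) *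
            ErrorCalculus.squareField A (f i) (f j) x ∂(P.map Y))) := by
  have hq := ErrorCalculus.isBiasForm_preForm hY hYn hα h𝒟 hA
  have : IsProbabilityMeasure (P.map Y) := Measure.isProbabilityMeasure_map hY.aemeasurable
  -- The abstract operator `B (f * g) - f * B g - g * B f`, with `B` the real part of `A`, is
  -- `squareField A` by definition.
  refine ⟨hq.isSquareField, fun p f hf F hF => ?_⟩
  obtain ⟨h1, h2⟩ := hq.tendsto_integral_incr_sq hlocal (f := f) hf hF
  refine ⟨h1, h2.congr fun n => ?_⟩
  have b : ErrorCalculus.IsBddMeas fun x => F fun k => f k x :=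
    ErrorCalculus.IsBddMeas.continuous_comp (fun i => hq.bddMeas _ (hf i)) hF.continuous
  exact ErrorCalculus.integral_pairMeasure hY hYn hα b.incr.sq.1 n
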